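/- **Conventions.** A (abstract) $\Sigma^*$-algebra is a $C^*$-algebra $\mathfrak B$ with a collection of pairs $((b_n),b)$, written $b_n\xrightarrow{\sigma}b$, for which there is a faithful nondegenerate representation $\pi:\mathfrak B\to B(\mathcal H)$ such that $\pi(\mathfrak B)$ is closed under limits of WOT-convergent sequences and $b_n\xrightarrow{\sigma}b$ if and only if $\pi(b_n)\to\pi(b)$ in the weak operator topology. A subset is $\sigma$-dense if the smallest subset containing it and closed under limits of $\sigma$-convergent sequences is all of $\mathfrak B$. A right $C^*$-module $\mathfrak X$ over $\mathfrak B$ is a right $\Sigma^*$-module if, whenever $\langle x_n|y\rangle$ is $\sigma$-convergent for every $y\in\mathfrak X$, there is $x\in\mathfrak X$ with $\langle x_n|y\rangle\xrightarrow{\sigma}\langle x|y\rangle$ for all $y$ (written $x_n\to_{\mathfrak B}x$); it is $\sigma$-full if the linear span of the elements $\langle x|y\rangle$ is $\sigma$-dense in $\mathfrak B$. Left modules are treated likewise. An $\mathfrak A$-$\mathfrak B$ bimodule $\mathfrak X$ is a $\Sigma^*$-imprimitivity bimodule if it is a $\sigma$-full left $\Sigma^*$-module over $\mathfrak A$ and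 a $\sigma$-full right $\Sigma^*$-module over $\mathfrak B$, ${}_{\mathfrak A}\langle x|y\rangle z=x\langle y|z\rangle_{\mathfrak B}$ for all $x,y,z\in\mathfrak X$, and $x_n\to_{\mathfrak A}x$ if and only if $x_n\to_{\mathfrak B}x$ for all sequences $(x_n)$ and all $x$ in $\mathfrak X$. If such an $\mathfrak X$ exists, $\mathfrak A$ and $\mathfrak B$ are strongly $\Sigma^*$-Morita equivalent. A $\Sigma^*$-Hilbert $\mathfrak A$-module is a Hilbert space with a nondegenerate representation of $\mathfrak A$ that takes $\sigma$-convergent sequences to WOT-convergent ones (preserving limits). With the bounded $\mathfrak A$-module maps as morphisms these form the category ${}_{\mathfrak A}\Sigma^*HMOD$. A $*$-functor is a linear functor $F$ with $F(T^*)=F(T)^*$. $\mathfrak A$ and $\mathfrak B$ are weakly $\Sigma^*$-Morita equivalent if there are $*$-functors $F:{}_{\mathfrak A}\Sigma^*HMOD\to{}_{\mathfrak B}\Sigma^*HMOD$ and $G:{}_{\mathfrak B}\Sigma^*HMOD\to{}_{\mathfrak A}\Sigma^*HMOD$ with natural isomorphisms $GF\cong\mathrm{id}$ and $FG\cong\mathrm{id}$.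 For a right $C^*$-module $E$ over $\mathfrak B$ and a Hilbert space $\mathcal H$ on which $\mathfrak B$ is represented, $E\otimes_{\mathfrak B}\mathcal H$ is the Hilbert space obtained from the algebraic tensor product by separation and completion with respect to $\langle x\otimes\zeta,y\otimes\eta\rangle=\langle\zeta,\langle x|y\rangle\eta\rangle$. $\overline{\mathfrak X}$ is the conjugate module of $\mathfrak X$, a right $C^*$-module over $\mathfrak A$ with $\overline x\,a=\overline{a^*x}$ and $\langle\overline x|\overline y\rangle={}_{\mathfrak A}\langle x|y\rangle$. **Proposition.** If $\mathfrak A$ and $\mathfrak B$ are strongly $\Sigma^*$-Morita equivalent $\Sigma^*$-algebras, then they are weakly $\Sigma^*$-Morita equivalent. More precisely, if $\mathfrak X$ is an $\mathfrak A$-$\mathfrak B$ $\Sigma^*$-imprimitivity bimodule, then there are $*$-functors $F:{}_{\mathfrak A}\Sigma^*HMOD\to{}_{\mathfrak B}\Sigma^*HMOD$ and $G:{}_{\mathfrak B}\Sigma^*HMOD\to{}_{\mathfrak A}\Sigma^*HMOD$, given up to unitary identification by $$F(\mathcal K)=\overline{\mathfrak X}\otimes_{\mathfrak A}\mathcal K,\quad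 b(\overline x\otimes\zeta)=\overline{xb^*}\otimes\zeta,\quad F(T)=\mathrm{id}\otimes T,\qquad G(\mathcal H)=\mathfrak X\otimes_{\mathfrak B}\mathcal H,\quad a(x\otimes\zeta)=ax\otimes\zeta,\quad G(S)=\mathrm{id}\otimes S,$$ and $GF$ and $FG$ are naturally isomorphic to the identity functors. -/

import Mathlib

open CategoryTheory Filter Topology
open scoped TensorProduct ComplexConjugate ComplexOrder

universe u u₁ u₂ v w

noncomputable section

namespace SigmaStar

/-! ### Sigma-star-algebras and their representations -/

/-- Convergence of a sequence of operators in the weak operator topology. -/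
def WOTConverges {H : Type*} [NormedAddCommGroup H] [InnerProductSpace ℂ H]
    (T : ℕ → H →L[ℂ] H) (S : H →L[ℂ] H) : Prop :=
  Tendsto (fun n => ContinuousLinearMapWOT.ofCLM (T n)) atTop
    (𝓝 (ContinuousLinearMapWOT.ofCLM S))

/-- A representation `π : A → B(H)` is nondegenerate if the vectors `π a ξ` span a dense
subspace of `H`. -/
def Nondegenerate {A H : Type*} [NonUnitalCStarAlgebra A]
    [NormedAddCommGroup H] [InnerProductSpace ℂ H] [CompleteSpace H]
    (π : A →⋆ₙₐ[ℂ] (H →L[ℂ] H)) : Prop :=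
  Dense (Submodule.span ℂ {η : H | ∃ (a : A) (ξ : H), π a ξ = η} : Set H)

/-- An abstract Σ*-algebra: a C*-algebra with a collection of pairs (sequence, element), the
σ-convergent sequences with their limits, for which there is a faithful nondegenerate
representation whose range is closed under limits of WOT-convergent sequences, and in which the
σ-convergent sequences are exactly those that are WOT-convergent to the image of the limit. -/
class SigmaStarAlgebra (A : Type u) [NonUnitalCStarAlgebra A] where
  /-- `sigmaConv b b₀` means that the sequence `b` is σ-convergent to `b₀`. -/
  sigmaConv : (ℕ → A) → A → Prop
  exists_faithful_representation :
    ∃ (H : Type u) (_ : NormedAddCommGroup H) (_ : InnerProductSpace ℂ H) (_ : CompleteSpace H)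
      (π : A →⋆ₙₐ[ℂ] (H →L[ℂ] H)),
      Function.Injective π ∧ Nondegenerate π ∧
      (∀ (b : ℕ → A) (T : H →L[ℂ] H), WOTConverges (fun n => π (b n)) T → T ∈ Set.range π) ∧
      (∀ (b : ℕ → A) (b₀ : A), sigmaConv b b₀ ↔ WOTConverges (fun n => π (b n)) (π b₀))

/-- A subset of a Σ*-algebra is σ-closed if it contains the limits of its σ-convergent
sequences. -/
def SigmaClosed {A : Type u} [NonUnitalCStarAlgebra A] [SigmaStarAlgebra A] (C : Set A) : Prop :=
  ∀ (b : ℕ → A) (b₀ : A), (∀ n, b n ∈ C) → SigmaStarAlgebra.sigmaConv b b₀ → b₀ ∈ C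

/-- The smallest σ-closed subset containing `S`. -/
def sigmaClosure {A : Type u} [NonUnitalCStarAlgebra A] [SigmaStarAlgebra A] (S : Set A) : Set A :=
  ⋂₀ {C : Set A | S ⊆ C ∧ SigmaClosed C}

/-! ### C*-modules

Imprimitivity bimodules need left and right C*-modules side by side. Mathlib's `CStarModule` has a
left action and an inner product that is linear in the second variable, which is neither of the two
conventions used here, and it fixes one norm on the module; so both kinds are defined below, each
with completeness in the norm of its own inner product. -/

/-- A right C*-module over a C*-algebra `B`: a complex vector space `X` with a right `B`-module
structure `rightAct x b = x b` and a `B`-valued inner product `rightInner x y = ⟨x|y⟩`, which is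
linear and `B`-linear in the second variable (hence conjugate-linear in the first), and such that
`X` is complete in the norm `‖⟨x|x⟩‖ ^ (1/2)`. -/
class RightCStarModule (B : Type*) (X : Type*) [NonUnitalCStarAlgebra B] [PartialOrder B]
    [StarOrderedRing B] [AddCommGroup X] [Module ℂ X] where
  rightAct : X → B → X
  add_rightAct : ∀ (x y : X) (b : B), rightAct (x + y) b = rightAct x b + rightAct y b
  rightAct_add : ∀ (x : X) (b c : B), rightAct x (b + c) = rightAct x b + rightAct x c
  rightAct_mul : ∀ (x : X) (b c : B), rightAct x (b * c) = rightAct (rightAct x b) c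
  smul_rightAct : ∀ (z : ℂ) (x : X) (b : B), rightAct (z • x) b = z • rightAct x b
  rightAct_smul : ∀ (z : ℂ) (x : X) (b : B), rightAct x (z • b) = z • rightAct x b
  rightInner : X → X → B
  rightInner_add : ∀ x y z : X, rightInner x (y + z) = rightInner x y + rightInner x z
  rightInner_smul : ∀ (x y : X) (z : ℂ), rightInner x (z • y) = z • rightInner x y
  rightInner_rightAct : ∀ (x y : X) (b : B), rightInner x (rightAct y b) = rightInner x y * b
  star_rightInner : ∀ x y : X, star (rightInner x y) = rightInner y x
  rightInner_self_nonneg : ∀ x : X, 0 ≤ rightInner x x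
  rightInner_definite : ∀ x : X, rightInner x x = 0 → x = 0
  right_complete : ∀ x : ℕ → X,
    (∀ ε > 0, ∃ N, ∀ m ≥ N, ∀ n ≥ N, √‖rightInner (x m - x n) (x m - x n)‖ < ε) →
    ∃ y : X, Tendsto (fun n => √‖rightInner (x n - y) (x n - y)‖) atTop (𝓝 0)

/-- A left C*-module over a C*-algebra `A`: a complex vector space `X` with a left `A`-module
structure `leftAct a x = a x` and an `A`-valued inner product `leftInner x y = ⟨x|y⟩`, which is
linear and `A`-linear in the first variable (hence conjugate-linear in the second), and such that
`X` is complete in the norm `‖⟨x|x⟩‖ ^ (1/2)`. -/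
class LeftCStarModule (A : Type*) (X : Type*) [NonUnitalCStarAlgebra A] [PartialOrder A]
    [StarOrderedRing A] [AddCommGroup X] [Module ℂ X] where
  leftAct : A → X → X
  leftAct_add : ∀ (a : A) (x y : X), leftAct a (x + y) = leftAct a x + leftAct a y
  add_leftAct : ∀ (a c : A) (x : X), leftAct (a + c) x = leftAct a x + leftAct c x
  mul_leftAct : ∀ (a c : A) (x : X), leftAct (a * c) x = leftAct a (leftAct c x)
  leftAct_smul : ∀ (z : ℂ) (a : A) (x : X), leftAct a (z • x) = z • leftAct a x
  smul_leftAct : ∀ (z : ℂ) (a : A) (x : X), leftAct (z • a) x = z • leftAct a x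
  leftInner : X → X → A
  add_leftInner : ∀ x y z : X, leftInner (x + y) z = leftInner x z + leftInner y z
  smul_leftInner : ∀ (x y : X) (z : ℂ), leftInner (z • x) y = z • leftInner x y
  leftAct_leftInner : ∀ (a : A) (x y : X), leftInner (leftAct a x) y = a * leftInner x y
  star_leftInner : ∀ x y : X, star (leftInner x y) = leftInner y x
  leftInner_self_nonneg : ∀ x : X, 0 ≤ leftInner x x
  leftInner_definite : ∀ x : X, leftInner x x = 0 → x = 0
  left_complete : ∀ x : ℕ → X,
    (∀ ε > 0, ∃ N, ∀ m ≥ N, ∀ n ≥ N, √‖leftInner (x m - x n) (x m - x n)‖ < ε) →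
    ∃ y : X, Tendsto (fun n => √‖leftInner (x n - y) (x n - y)‖) atTop (𝓝 0)

open RightCStarModule (rightAct rightInner)
open LeftCStarModule (leftAct leftInner)

section BasicFacts

variable {B : Type*} {X : Type*} [NonUnitalCStarAlgebra B] [PartialOrder B] [StarOrderedRing B]
  [AddCommGroup X] [Module ℂ X]

theorem rightInner_add_left [RightCStarModule B X] (x y z : X) :
    (rightInner (x + y) z : B) = rightInner x z + rightInner y z := by
  rw [← RightCStarModule.star_rightInner, RightCStarModule.rightInner_add, star_add,
    RightCStarModule.star_rightInner, RightCStarModule.star_rightInner]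

theorem rightInner_smul_left [RightCStarModule B X] (c : ℂ) (x y : X) :
    (rightInner (c • x) y : B) = star c • rightInner x y := by
  rw [← RightCStarModule.star_rightInner, RightCStarModule.rightInner_smul, star_smul,
    RightCStarModule.star_rightInner]

theorem rightInner_rightAct_left [RightCStarModule B X] (x y : X) (b : B) :
    (rightInner (rightAct x b) y : B) = star b * rightInner x y := by
  rw [← RightCStarModule.star_rightInner, RightCStarModule.rightInner_rightAct, star_mul,
    RightCStarModule.star_rightInner]

theorem leftInner_add_right [LeftCStarModule B X] (x y z : X) :
    (leftInner x (y + z) : B) = leftInner x y + leftInner x z := by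
  rw [← LeftCStarModule.star_leftInner, LeftCStarModule.add_leftInner, star_add,
    LeftCStarModule.star_leftInner, LeftCStarModule.star_leftInner]

theorem leftInner_smul_right [LeftCStarModule B X] (c : ℂ) (x y : X) :
    (leftInner x (c • y) : B) = star c • leftInner x y := by
  rw [← LeftCStarModule.star_leftInner, LeftCStarModule.smul_leftInner, star_smul,
    LeftCStarModule.star_leftInner]

theorem leftInner_leftAct_right [LeftCStarModule B X] (b : B) (x y : X) :
    (leftInner x (leftAct b y) : B) = leftInner x y * star b := by
  rw [← LeftCStarModule.star_leftInner, LeftCStarModule.leftAct_leftInner, star_mul,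
    LeftCStarModule.star_leftInner]

end BasicFacts

/-! ### The conjugate module -/

/-- The conjugate of a complex vector space `X`: the same additive group, an element `x` of `X`
being written `bar x` in the conjugate, with `z • bar x = bar (conj z • x)`. -/
@[ext]
structure Conjugate (X : Type*) where
  bar ::
  unbar : X

namespace Conjugate

variable {X : Type*}

/-- The identity map from the conjugate to the original space. -/
def equiv (X : Type*) : Conjugate X ≃ X where
  toFun := unbar
  invFun := bar
  left_inv _ := rfl
  right_inv _ := rfl

instance [AddCommGroup X] : AddCommGroup (Conjugate X) := (equiv X).addCommGroup

instance [AddCommGroup X] [Module ℂ X] : Module ℂ (Conjugate X) where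
  smul z x := bar (conj z • x.unbar)
  one_smul x := Conjugate.ext (by change conj (1 : ℂ) • x.unbar = x.unbar; simp)
  mul_smul z t x := Conjugate.ext (by
    change conj (z * t) • x.unbar = conj z • conj t • x.unbar; simp [mul_smul])
  smul_zero z := Conjugate.ext (by change conj z • (0 : X) = 0; simp)
  smul_add z x y := Conjugate.ext (by
    change conj z • (x.unbar + y.unbar) = conj z • x.unbar + conj z • y.unbar; simp)
  add_smul z t x := Conjugate.ext (by
    change conj (z + t) • x.unbar = conj z • x.unbar + conj t • x.unbar; simp [add_smul])
  zero_smul x := Conjugate.ext (by change conj (0 : ℂ) • x.unbar = 0; simp)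

/-- The conjugate of a left C*-module over `A` is a right C*-module over `A`, with right action
`(bar x) a = bar (a* x)` and inner product `⟨bar x|bar y⟩ = ⟨x|y⟩`. -/
instance {A : Type*} [NonUnitalCStarAlgebra A] [PartialOrder A] [StarOrderedRing A]
    [AddCommGroup X] [Module ℂ X] [LeftCStarModule A X] : RightCStarModule A (Conjugate X) where
  rightAct x a := bar (leftAct (star a) x.unbar)
  add_rightAct x y a := Conjugate.ext (LeftCStarModule.leftAct_add _ _ _)
  rightAct_add x a c := Conjugate.ext (by
    change leftAct (star (a + c)) x.unbar = leftAct (star a) x.unbar + leftAct (star c) x.unbar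
    rw [star_add, LeftCStarModule.add_leftAct])
  rightAct_mul x a c := Conjugate.ext (by
    change leftAct (star (a * c)) x.unbar = leftAct (star c) (leftAct (star a) x.unbar)
    rw [star_mul, LeftCStarModule.mul_leftAct])
  smul_rightAct z x a := Conjugate.ext (LeftCStarModule.leftAct_smul _ _ _)
  rightAct_smul z x a := Conjugate.ext (by
    change leftAct (star (z • a)) x.unbar = conj z • leftAct (star a) x.unbar
    rw [star_smul, LeftCStarModule.smul_leftAct]; rfl)
  rightInner x y := leftInner x.unbar y.unbar
  rightInner_add x y z := leftInner_add_right _ _ _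
  rightInner_smul x y z := by
    change (leftInner x.unbar (conj z • y.unbar) : A) = _
    rw [leftInner_smul_right]; simp
  rightInner_rightAct x y a := by
    change (leftInner x.unbar (leftAct (star a) y.unbar) : A) = _
    rw [leftInner_leftAct_right, star_star]
  star_rightInner x y := LeftCStarModule.star_leftInner _ _
  rightInner_self_nonneg x := LeftCStarModule.leftInner_self_nonneg _
  rightInner_definite x hx := Conjugate.ext (LeftCStarModule.leftInner_definite _ hx)
  right_complete x hx := by
    obtain ⟨y, hy⟩ := LeftCStarModule.left_complete (A := A) (fun n => (x n).unbar) hx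
    exact ⟨bar y, hy⟩

end Conjugate

/-! ### The interior tensor product of a C*-module with a representation -/

section Positivity

attribute [local instance] CStarAlgebra.spectralOrder CStarAlgebra.spectralOrderedRing

/-- A selfadjoint element of a C*-algebra is the difference of two positive elements with product
zero. -/
theorem exists_pos_neg_parts {R : Type*} [NonUnitalCStarAlgebra R] (M : R) (hM : star M = M) :
    ∃ Q S N : R, star Q = Q ∧ star S = S ∧ star N = N ∧ S * S = Q ∧ Q * M = -(Q * Q) ∧
      M = N * N - Q := by
  have hMsa : IsSelfAdjoint M := hM
  have hQ0 : 0 ≤ M⁻ := CFC.negPart_nonneg M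
  have hP0 : 0 ≤ M⁺ := CFC.posPart_nonneg M
  refine ⟨M⁻, CFC.sqrt M⁻, CFC.sqrt M⁺, hQ0.isSelfAdjoint, (CFC.sqrt_nonneg _).isSelfAdjoint,
    (CFC.sqrt_nonneg _).isSelfAdjoint, CFC.sqrt_mul_sqrt_self _ hQ0, ?_, ?_⟩
  · conv_lhs => enter [2]; rw [← CFC.posPart_sub_negPart M hMsa]
    rw [mul_sub, CFC.negPart_mul_posPart, zero_sub]
  · rw [CFC.sqrt_mul_sqrt_self _ hP0, CFC.posPart_sub_negPart M hMsa]

end Positivity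

/-- A matrix `M` over a C*-algebra with `∑ i j, (c i)* M i j c j ≥ 0` for all columns `c` is of the
form `N* N`. -/
theorem exists_matrix_eq_star_mul_self {A : Type*} [NonUnitalCStarAlgebra A] [PartialOrder A]
    [StarOrderedRing A] {k : ℕ} (M : CStarMatrix (Fin k) (Fin k) A) (hM : star M = M)
    (hpos : ∀ c : Fin k → A, 0 ≤ ∑ i, ∑ j, star (c i) * M i j * c j) :
    ∃ N : CStarMatrix (Fin k) (Fin k) A, M = star N * N := by
  obtain ⟨Q, S, N, hQs, hSs, hNs, hS, hQM, hMN⟩ := exists_pos_neg_parts M hM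
  have h1 : Q * M * Q = -(Q * Q * Q) := by rw [hQM, neg_mul]
  have h3 : Q * Q * Q = star (S * Q) * (S * Q) := by
    rw [star_mul, hSs, hQs, mul_assoc Q S, ← mul_assoc S S, hS, mul_assoc]
  have hdiag : ∀ i, ∑ l, star ((S * Q) l i) * (S * Q) l i = 0 := by
    intro i
    have e1 : (Q * M * Q) i i = ∑ a, ∑ b, star (Q a i) * M a b * Q b i := by
      simp only [CStarMatrix.mul_apply, Finset.sum_mul]
      rw [Finset.sum_comm]
      refine Finset.sum_congr rfl fun a _ => Finset.sum_congr rfl fun b _ => ?_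
      rw [← CStarMatrix.star_apply, hQs]
    have e2 : (Q * Q * Q) i i = ∑ l, star ((S * Q) l i) * (S * Q) l i := by
      rw [h3, CStarMatrix.mul_apply]
      rfl
    have e3 : 0 ≤ -∑ l, star ((S * Q) l i) * (S * Q) l i := by
      rw [← e2, ← CStarMatrix.neg_apply, ← h1, e1]
      exact hpos fun a => Q a i
    exact le_antisymm (neg_nonneg.mp e3)
      (Finset.sum_nonneg fun l _ => star_mul_self_nonneg _)
  have hW : S * Q = 0 := by
    ext l i
    have := (Finset.sum_eq_zero_iff_of_nonneg
      (fun l _ => star_mul_self_nonneg ((S * Q) l i))).mp (hdiag i) l (Finset.mem_univ _)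
    exact CStarRing.star_mul_self_eq_zero_iff _ |>.mp this
  have hQQ : Q * Q = 0 := by
    nth_rewrite 1 [← hS]
    rw [mul_assoc, hW, mul_zero]
  have hQz : Q = 0 := by
    have : star Q * Q = 0 := by rw [hQs, hQQ]
    exact CStarRing.star_mul_self_eq_zero_iff _ |>.mp this
  exact ⟨N, by rw [hNs, hMN, hQz, sub_zero]⟩

section InteriorTensor

variable {B : Type*} {E : Type*} {K : Type*} [NonUnitalCStarAlgebra B] [PartialOrder B]
  [StarOrderedRing B] [AddCommGroup E] [Module ℂ E] [RightCStarModule B E]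
  [NormedAddCommGroup K] [InnerProductSpace ℂ K] [CompleteSpace K]

/-- The sesquilinear form on the algebraic tensor product `E ⊗ K` over `ℂ` with
`⟨x ⊗ ζ, y ⊗ η⟩ = ⟨ζ, π(⟨x|y⟩) η⟩`. -/
def tensorForm (E : Type*) [AddCommGroup E] [Module ℂ E] [RightCStarModule B E]
    (π : B →⋆ₙₐ[ℂ] (K →L[ℂ] K)) : (E ⊗[ℂ] K) →ₗ⋆[ℂ] (E ⊗[ℂ] K) →ₗ[ℂ] ℂ :=
  TensorProduct.lift <| LinearMap.mk₂'ₛₗ (starRingEnd ℂ) (starRingEnd ℂ)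
    (fun (x : E) (ζ : K) => TensorProduct.lift <| LinearMap.mk₂ ℂ
      (fun (y : E) (η : K) => inner ℂ ζ (π (rightInner x y) η))
      (fun y y' η => by simp [RightCStarModule.rightInner_add])
      (fun c y η => by simp [RightCStarModule.rightInner_smul])
      (fun y η η' => by simp)
      (fun c y η => by simp))
    (fun x x' ζ => TensorProduct.ext' fun y η => by simp [rightInner_add_left])
    (fun c x ζ => TensorProduct.ext' fun y η => by simp [rightInner_smul_left])
    (fun x ζ ζ' => TensorProduct.ext' fun y η => by simp)
    (fun c x ζ => TensorProduct.ext' fun y η => by simp [mul_comm])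

theorem tensorForm_tmul (π : B →⋆ₙₐ[ℂ] (K →L[ℂ] K)) (x y : E) (ζ η : K) :
    tensorForm E π (x ⊗ₜ[ℂ] ζ) (y ⊗ₜ[ℂ] η) = inner ℂ ζ (π (rightInner x y) η) := rfl

theorem tensorForm_conj_symm (π : B →⋆ₙₐ[ℂ] (K →L[ℂ] K)) (s t : E ⊗[ℂ] K) :
    conj (tensorForm E π t s) = tensorForm E π s t := by
  induction s with
  | zero => simp
  | add s s' hs hs' => simp [hs, hs']
  | tmul x ζ =>
    induction t with
    | zero => simp
    | add t t' ht ht' => simp [ht, ht']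
    | tmul y η =>
      rw [tensorForm_tmul, tensorForm_tmul, inner_conj_symm,
        ← RightCStarModule.star_rightInner y x, map_star, ContinuousLinearMap.star_eq_adjoint,
        ContinuousLinearMap.adjoint_inner_right]

theorem rightInner_sum_right {ι : Type*} (s : Finset ι) (x : E) (y : ι → E) :
    (rightInner x (∑ i ∈ s, y i) : B) = ∑ i ∈ s, rightInner x (y i) :=
  map_sum (AddMonoidHom.mk' (fun y => (rightInner x y : B)) (RightCStarModule.rightInner_add x)) _ _

theorem rightInner_sum_left {ι : Type*} (s : Finset ι) (x : ι → E) (y : E) :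
    (rightInner (∑ i ∈ s, x i) y : B) = ∑ i ∈ s, rightInner (x i) y :=
  map_sum (AddMonoidHom.mk' (fun x => (rightInner x y : B))
    (fun x x' => rightInner_add_left x x' y)) _ _

theorem tensorForm_self_nonneg (π : B →⋆ₙₐ[ℂ] (K →L[ℂ] K)) (t : E ⊗[ℂ] K) :
    0 ≤ RCLike.re (tensorForm E π t t) := by
  obtain ⟨k, x, ζ, rfl⟩ := TensorProduct.exists_sum_tmul_eq t
  obtain ⟨N, hN⟩ := exists_matrix_eq_star_mul_self
    (CStarMatrix.ofMatrix fun i j => (rightInner (x i) (x j) : B))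
    (CStarMatrix.ext fun i j => RightCStarModule.star_rightInner (x j) (x i))
    (fun c => by
      have h := RightCStarModule.rightInner_self_nonneg (B := B) (∑ i, rightAct (x i) (c i))
      rw [rightInner_sum_left] at h
      refine h.trans_eq (Finset.sum_congr rfl fun i _ => ?_)
      rw [rightInner_sum_right]
      refine Finset.sum_congr rfl fun j _ => ?_
      rw [RightCStarModule.rightInner_rightAct, rightInner_rightAct_left]
      rfl)
  have hN' : ∀ i j, (rightInner (x i) (x j) : B) = ∑ l, star (N l i) * N l j := fun i j => by
    have := congrArg (fun M : CStarMatrix (Fin k) (Fin k) B => M i j) hN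
    rw [CStarMatrix.mul_apply] at this
    exact this
  have key : tensorForm E π (∑ i, x i ⊗ₜ[ℂ] ζ i) (∑ i, x i ⊗ₜ[ℂ] ζ i)
      = ∑ l, inner ℂ (∑ i, π (N l i) (ζ i)) (∑ j, π (N l j) (ζ j)) := by
    simp only [map_sum, LinearMap.sum_apply, tensorForm_tmul, sum_inner, inner_sum, hN', map_mul,
      map_star, sum_apply, mul_apply_eq_comp,
      ContinuousLinearMap.star_eq_adjoint, ContinuousLinearMap.adjoint_inner_right]
    rw [Finset.sum_comm]
    conv_rhs => rw [Finset.sum_comm]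
    conv_rhs => enter [2, i]; rw [Finset.sum_comm]
    rw [Finset.sum_comm]
  rw [key, map_sum]
  exact Finset.sum_nonneg fun l _ => inner_self_nonneg

/-- The algebraic tensor product `E ⊗ K` over `ℂ`, to be equipped with the semi-inner product of
`tensorForm`. -/
def PreTensor (E : Type*) [AddCommGroup E] [Module ℂ E] [RightCStarModule B E]
    (_π : B →⋆ₙₐ[ℂ] (K →L[ℂ] K)) : Type _ := E ⊗[ℂ] K

instance (π : B →⋆ₙₐ[ℂ] (K →L[ℂ] K)) : AddCommGroup (PreTensor E π) :=
  inferInstanceAs (AddCommGroup (E ⊗[ℂ] K))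

instance (π : B →⋆ₙₐ[ℂ] (K →L[ℂ] K)) : Module ℂ (PreTensor E π) :=
  inferInstanceAs (Module ℂ (E ⊗[ℂ] K))

/-- The semi-inner product on the algebraic tensor product. -/
abbrev preTensorCore (E : Type*) [AddCommGroup E] [Module ℂ E] [RightCStarModule B E]
    (π : B →⋆ₙₐ[ℂ] (K →L[ℂ] K)) : PreInnerProductSpace.Core ℂ (PreTensor E π) where
  inner s t := tensorForm E π s t
  conj_inner_symm s t := tensorForm_conj_symm π s t
  re_inner_nonneg t := tensorForm_self_nonneg π t
  add_left s t r := LinearMap.map_add₂ (tensorForm E π) s t r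
  smul_left s t c := LinearMap.map_smulₛₗ₂ (tensorForm E π) c s t

instance (π : B →⋆ₙₐ[ℂ] (K →L[ℂ] K)) : SeminormedAddCommGroup (PreTensor E π) :=
  @InnerProductSpace.Core.toSeminormedAddCommGroup ℂ _ _ _ _ (preTensorCore E π)

instance (π : B →⋆ₙₐ[ℂ] (K →L[ℂ] K)) : InnerProductSpace ℂ (PreTensor E π) :=
  InnerProductSpace.ofCore (preTensorCore E π)

/-- The interior tensor product of the right C*-module `E` over `B` with the Hilbert space `K` on
which `B` is represented by `π`: the Hilbert space obtained from the algebraic tensor product with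
semi-inner product `⟨x ⊗ ζ, y ⊗ η⟩ = ⟨ζ, π(⟨x|y⟩) η⟩` by separation and completion. The tensor
product is balanced over `B`, since the vectors `x b ⊗ ζ - x ⊗ π(b) ζ` have seminorm zero. -/
abbrev InteriorTensor (E : Type*) [AddCommGroup E] [Module ℂ E] [RightCStarModule B E]
    (π : B →⋆ₙₐ[ℂ] (K →L[ℂ] K)) : Type _ :=
  UniformSpace.Completion (PreTensor E π)

/-- The simple tensor `x ⊗ ζ` in the algebraic tensor product. -/
def preTmul (π : B →⋆ₙₐ[ℂ] (K →L[ℂ] K)) (x : E) (ζ : K) : PreTensor E π := x ⊗ₜ[ℂ] ζ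

/-- The simple tensor `x ⊗ ζ` in the interior tensor product. -/
def simpleTensor (π : B →⋆ₙₐ[ℂ] (K →L[ℂ] K)) (x : E) (ζ : K) : InteriorTensor E π :=
  (preTmul π x ζ : UniformSpace.Completion (PreTensor E π))

theorem inner_simpleTensor (π : B →⋆ₙₐ[ℂ] (K →L[ℂ] K)) (x y : E) (ζ η : K) :
    inner ℂ (simpleTensor π x ζ) (simpleTensor π y η) = inner ℂ ζ (π (rightInner x y) η) :=
  UniformSpace.Completion.inner_coe (preTmul π x ζ) (preTmul π y η)

end InteriorTensor

/-! ### Imprimitivity bimodules and strong Morita equivalence -/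

section Morita

variable (A : Type u₁) (B : Type u₂) (X : Type v)
  [NonUnitalCStarAlgebra A] [PartialOrder A] [StarOrderedRing A] [SigmaStarAlgebra A]
  [NonUnitalCStarAlgebra B] [PartialOrder B] [StarOrderedRing B] [SigmaStarAlgebra B]
  [AddCommGroup X] [Module ℂ X]

/-- `x n → x₀` in the sense that `⟨x n|y⟩` is σ-convergent to `⟨x₀|y⟩` for all `y`, for a right
C*-module. -/
def RightSigmaConverges [RightCStarModule B X] (x : ℕ → X) (x₀ : X) : Prop :=
  ∀ y : X, SigmaStarAlgebra.sigmaConv (fun n => (rightInner (x n) y : B)) (rightInner x₀ y)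

/-- `x n → x₀` in the sense that `⟨x n|y⟩` is σ-convergent to `⟨x₀|y⟩` for all `y`, for a left
C*-module. -/
def LeftSigmaConverges [LeftCStarModule A X] (x : ℕ → X) (x₀ : X) : Prop :=
  ∀ y : X, SigmaStarAlgebra.sigmaConv (fun n => (leftInner (x n) y : A)) (leftInner x₀ y)

/-- A right C*-module over a Σ*-algebra is a right Σ*-module if every sequence `x` such that
`⟨x n|y⟩` is σ-convergent for all `y` converges to some `x₀` in the above sense. -/
def IsRightSigmaModule [RightCStarModule B X] : Prop :=
  ∀ x : ℕ → X,
    (∀ y : X, ∃ b : B, SigmaStarAlgebra.sigmaConv (fun n => (rightInner (x n) y : B)) b) →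
    ∃ x₀ : X, RightSigmaConverges B X x x₀

/-- A left C*-module over a Σ*-algebra is a left Σ*-module if every sequence `x` such that
`⟨x n|y⟩` is σ-convergent for all `y` converges to some `x₀` in the above sense. -/
def IsLeftSigmaModule [LeftCStarModule A X] : Prop :=
  ∀ x : ℕ → X,
    (∀ y : X, ∃ a : A, SigmaStarAlgebra.sigmaConv (fun n => (leftInner (x n) y : A)) a) →
    ∃ x₀ : X, LeftSigmaConverges A X x x₀

/-- A right module is σ-full if the span of the range of the inner product is σ-dense. -/
def IsRightSigmaFull [RightCStarModule B X] : Prop :=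
  sigmaClosure (Submodule.span ℂ {b : B | ∃ x y : X, rightInner x y = b} : Set B) = Set.univ

/-- A left module is σ-full if the span of the range of the inner product is σ-dense. -/
def IsLeftSigmaFull [LeftCStarModule A X] : Prop :=
  sigmaClosure (Submodule.span ℂ {a : A | ∃ x y : X, leftInner x y = a} : Set A) = Set.univ

/-- `X` is an `A`-`B` Σ*-imprimitivity bimodule. -/
structure IsSigmaImprimitivityBimodule [LeftCStarModule A X] [RightCStarModule B X] : Prop where
  act_comm : ∀ (a : A) (x : X) (b : B), rightAct (leftAct a x) b = leftAct a (rightAct x b)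
  left_module : IsLeftSigmaModule A X
  left_full : IsLeftSigmaFull A X
  right_module : IsRightSigmaModule B X
  right_full : IsRightSigmaFull B X
  inner_act : ∀ x y z : X, leftAct (leftInner x y : A) z = rightAct x (rightInner y z : B)
  converges_iff : ∀ (x : ℕ → X) (x₀ : X),
    LeftSigmaConverges A X x x₀ ↔ RightSigmaConverges B X x x₀

/-- Strong Σ*-Morita equivalence: there is an `A`-`B` Σ*-imprimitivity bimodule. -/
def StronglySigmaMoritaEquivalent : Prop :=
  ∃ (X : Type v) (_ : AddCommGroup X) (_ : Module ℂ X) (_ : LeftCStarModule A X)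
    (_ : RightCStarModule B X), IsSigmaImprimitivityBimodule A B X

end Morita

/-! ### The category of Hilbert modules and weak Morita equivalence -/

section HilbertModules

/-- A Σ*-Hilbert `A`-module: a Hilbert space with a Σ*-representation of `A`, that is, a
nondegenerate representation which maps σ-convergent to WOT-convergent sequences. -/
structure SigmaHilbertModule (A : Type u) [NonUnitalCStarAlgebra A] [SigmaStarAlgebra A] where
  carrier : Type w
  [normed : NormedAddCommGroup carrier]
  [innerProduct : InnerProductSpace ℂ carrier]
  [complete : CompleteSpace carrier]
  rep : A →⋆ₙₐ[ℂ] (carrier →L[ℂ] carrier)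
  nondegenerate : Nondegenerate rep
  sigma_continuous : ∀ (a : ℕ → A) (a₀ : A), SigmaStarAlgebra.sigmaConv a a₀ →
    WOTConverges (fun n => rep (a n)) (rep a₀)

namespace SigmaHilbertModule

attribute [instance] normed innerProduct complete

variable {A : Type u} [NonUnitalCStarAlgebra A] [SigmaStarAlgebra A]

/-- Morphisms: the bounded `A`-module maps. -/
@[ext]
structure Hom (H K : SigmaHilbertModule.{u, w} A) where
  toCLM : H.carrier →L[ℂ] K.carrier
  map_rep : ∀ (a : A) (ξ : H.carrier), toCLM (H.rep a ξ) = K.rep a (toCLM ξ)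

instance : Category (SigmaHilbertModule.{u, w} A) where
  Hom H K := Hom H K
  id H := ⟨ContinuousLinearMap.id ℂ H.carrier, fun _ _ => rfl⟩
  comp S T := ⟨T.toCLM.comp S.toCLM, fun a ξ => by simp [S.map_rep, T.map_rep]⟩

variable {H K : SigmaHilbertModule.{u, w} A}

/-- The bounded operator underlying a morphism. -/
def toCLM (T : H ⟶ K) : H.carrier →L[ℂ] K.carrier := Hom.toCLM T

instance : Add (H ⟶ K) :=
  ⟨fun S T => ⟨toCLM S + toCLM T, fun a ξ => by
    change toCLM S (H.rep a ξ) + toCLM T (H.rep a ξ) = K.rep a (toCLM S ξ + toCLM T ξ)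
    rw [map_add]
    exact congrArg₂ _ (S.map_rep a ξ) (T.map_rep a ξ)⟩⟩

instance : SMul ℂ (H ⟶ K) :=
  ⟨fun z T => ⟨z • toCLM T, fun a ξ => by
    change z • toCLM T (H.rep a ξ) = K.rep a (z • toCLM T ξ)
    rw [map_smul]
    exact congrArg _ (T.map_rep a ξ)⟩⟩

/-- The Hilbert space adjoint of a module map, which is again a module map. -/
def adjoint (T : H ⟶ K) : K ⟶ H :=
  ⟨ContinuousLinearMap.adjoint (toCLM T), fun a ξ => by
    refine ext_inner_right ℂ fun ζ => ?_
    have hT : toCLM T (H.rep (star a) ζ) = K.rep (star a) (toCLM T ζ) := T.map_rep _ _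
    have hH : H.rep a = ContinuousLinearMap.adjoint (H.rep (star a)) := by
      rw [map_star, ContinuousLinearMap.star_eq_adjoint, ContinuousLinearMap.adjoint_adjoint]
    have hK : K.rep a = ContinuousLinearMap.adjoint (K.rep (star a)) := by
      rw [map_star, ContinuousLinearMap.star_eq_adjoint, ContinuousLinearMap.adjoint_adjoint]
    rw [hH, hK, ContinuousLinearMap.adjoint_inner_left, ContinuousLinearMap.adjoint_inner_left,
      ContinuousLinearMap.adjoint_inner_left, ContinuousLinearMap.adjoint_inner_left, hT]⟩

end SigmaHilbertModule

open SigmaHilbertModule (toCLM adjoint)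

variable {A : Type u₁} {B : Type u₂} [NonUnitalCStarAlgebra A] [SigmaStarAlgebra A]
  [NonUnitalCStarAlgebra B] [SigmaStarAlgebra B]

/-- A *-functor: a linear functor with `F (T*) = (F T)*`. -/
structure IsStarFunctor (F : SigmaHilbertModule.{u₁, w} A ⥤ SigmaHilbertModule.{u₂, w} B) :
    Prop where
  map_add : ∀ {H K : SigmaHilbertModule.{u₁, w} A} (S T : H ⟶ K),
    F.map (S + T) = F.map S + F.map T
  map_smul : ∀ {H K : SigmaHilbertModule.{u₁, w} A} (z : ℂ) (T : H ⟶ K),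
    F.map (z • T) = z • F.map T
  map_adjoint : ∀ {H K : SigmaHilbertModule.{u₁, w} A} (T : H ⟶ K),
    F.map (adjoint T) = adjoint (F.map T)

/-- Weak Σ*-Morita equivalence: the categories of Σ*-Hilbert modules are equivalent via
*-functors. -/
def WeaklySigmaMoritaEquivalent (A : Type u₁) (B : Type u₂) [NonUnitalCStarAlgebra A]
    [SigmaStarAlgebra A] [NonUnitalCStarAlgebra B] [SigmaStarAlgebra B] : Prop :=
  ∃ (F : SigmaHilbertModule.{u₁, w} A ⥤ SigmaHilbertModule.{u₂, w} B)
    (G : SigmaHilbertModule.{u₂, w} B ⥤ SigmaHilbertModule.{u₁, w} A),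
    IsStarFunctor F ∧ IsStarFunctor G ∧
    Nonempty (F ⋙ G ≅ 𝟭 (SigmaHilbertModule.{u₁, w} A)) ∧
    Nonempty (G ⋙ F ≅ 𝟭 (SigmaHilbertModule.{u₂, w} B))

/-- The functor `F` is (up to unitary identification) the functor `K ↦ E ⊗ K`, `T ↦ id ⊗ T`, where
`⊗` is the interior tensor product over `A`, the module structure of `E ⊗ K` over `B` being
`b (x ⊗ ζ) = (act b x) ⊗ ζ`. -/
def IsTensorFunctor [PartialOrder A] [StarOrderedRing A]
    (E : Type v) [AddCommGroup E] [Module ℂ E] [RightCStarModule A E] (act : B → E → E)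
    (F : SigmaHilbertModule.{u₁, w} A ⥤ SigmaHilbertModule.{u₂, w} B) : Prop :=
  ∃ U : ∀ K : SigmaHilbertModule.{u₁, w} A, InteriorTensor E K.rep ≃ₗᵢ[ℂ] (F.obj K).carrier,
    (∀ (K : SigmaHilbertModule.{u₁, w} A) (b : B) (x : E) (ζ : K.carrier),
      (F.obj K).rep b (U K (simpleTensor K.rep x ζ)) = U K (simpleTensor K.rep (act b x) ζ)) ∧
    (∀ (K L : SigmaHilbertModule.{u₁, w} A) (T : K ⟶ L) (x : E) (ζ : K.carrier),
      toCLM (F.map T) (U K (simpleTensor K.rep x ζ)) = U L (simpleTensor L.rep x (toCLM T ζ)))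

end HilbertModules

end SigmaStar

end

open SigmaStar

namespace SigmaStar

open SigmaStar.RightCStarModule (rightAct rightInner)
open SigmaStar.LeftCStarModule (leftAct leftInner)
open SigmaStar.SigmaStarAlgebra (sigmaConv)
open SigmaStar.SigmaHilbertModule (toCLM adjoint)
open UniformSpace (Completion)

/-! ### Convergence in the weak operator topology -/

/-! This is Rieffel's argument with weak-* continuity replaced by σ-continuity. Both functors come
from one construction, `IsSigmaCorrespondence.tensorFunctor`, applied to `X` (from `B`-modules to
`A`-modules) and to its conjugate (from `A` to `B`).

For a correspondence `E` and a Σ*-Hilbert module `K`, the space `E ⊗ K` must again be a Σ*-Hilbert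
module. The action is bounded because it preserves adjoints (`norm_apply_le_of_adjoint`). It is
nondegenerate because `x⟨y|z⟩ ⊗ ζ` lies in its range and the inner products are σ-dense. It is
σ-continuous because σ-convergent sequences are bounded, so that simple tensors suffice for testing,
and there the coefficients are `⟨ζ, π(⟨x|a y⟩) η⟩`. That `⟨x|a y⟩` is σ-continuous in `a` is where
the agreement of the two convergences on `X` enters.

The isomorphism of the composite with the identity is `x ⊗ (x̄' ⊗ ζ) ↦ ⟨x|x'⟩ ζ`. The relation
`⟨x|y⟩z = x⟨y|z⟩` shows that it preserves inner products, and σ-fullness gives dense range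
(`exists_unitary_of_pairing`). Throughout, a statement about all `a` is reduced to inner products by
the fact that the kernel of a σ-continuous functional is σ-closed (`eq_zero_of_sigmaClosure_span`).
-/

theorem wotConverges_iff {H : Type*} [NormedAddCommGroup H] [InnerProductSpace ℂ H]
    [CompleteSpace H] {T : ℕ → H →L[ℂ] H} {S : H →L[ℂ] H} :
    WOTConverges T S ↔
      ∀ ξ η : H, Tendsto (fun n => inner ℂ ξ (T n η)) atTop (𝓝 (inner ℂ ξ (S η))) := by
  rw [WOTConverges, ContinuousLinearMapWOT.tendsto_iff_forall_dual_apply_tendsto]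
  constructor
  · intro h ξ η
    exact h η (InnerProductSpace.toDual ℂ H ξ)
  · intro h η f
    obtain ⟨ξ, rfl⟩ := (InnerProductSpace.toDual ℂ H).surjective f
    exact h ξ η

/-- A sequence of operators that converges in the weak operator topology is bounded. -/
theorem WOTConverges.exists_norm_le {H : Type*} [NormedAddCommGroup H] [InnerProductSpace ℂ H]
    [CompleteSpace H] {T : ℕ → H →L[ℂ] H} {S : H →L[ℂ] H} (h : WOTConverges T S) :
    ∃ C, ∀ n, ‖T n‖ ≤ C := by
  rw [wotConverges_iff] at h
  -- Uniform boundedness is used twice: for fixed `η`, on the functionals `⟨T n η, ·⟩`, to bound `‖T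
  -- n η‖`, and then on the operators themselves.
  refine banach_steinhaus fun η => ?_
  obtain ⟨C, hC⟩ := banach_steinhaus (g := fun n => InnerProductSpace.toDual ℂ H (T n η))
    fun ξ => by
      obtain ⟨C, hC⟩ := (h ξ η).norm.bddAbove_range
      refine ⟨C, fun n => ?_⟩
      rw [InnerProductSpace.toDual_apply_apply, norm_inner_symm]
      exact hC ⟨n, rfl⟩
  exact ⟨C, fun n => by simpa using hC n⟩

/-- For a bounded sequence of operators, convergence in the weak operator topology can be tested
on a family of vectors with dense span. -/
theorem wotConverges_of_dense_span {H : Type*} [NormedAddCommGroup H] [InnerProductSpace ℂ H]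
    [CompleteSpace H] {T : ℕ → H →L[ℂ] H} {S : H →L[ℂ] H} {C : ℝ} (hC : ∀ n, ‖T n‖ ≤ C)
    {s : Set H} (hs : Dense (Submodule.span ℂ s : Set H))
    (h : ∀ ξ ∈ s, ∀ η ∈ s, Tendsto (fun n => inner ℂ ξ (T n η)) atTop (𝓝 (inner ℂ ξ (S η)))) :
    WOTConverges T S := by
  rw [wotConverges_iff]
  have hspan : ∀ ξ ∈ Submodule.span ℂ s, ∀ η ∈ Submodule.span ℂ s,
      Tendsto (fun n => inner ℂ ξ (T n η)) atTop (𝓝 (inner ℂ ξ (S η))) := by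
    intro ξ hξ η hη
    induction hξ using Submodule.span_induction with
    | mem ξ hξ =>
      induction hη using Submodule.span_induction with
      | mem η hη => exact h ξ hξ η hη
      | zero => simp
      | add x y _ _ hx hy => simpa [inner_add_right] using hx.add hy
      | smul c x _ hx => simpa [inner_smul_right] using hx.const_mul c
    | zero => simp
    | add x y _ _ hx hy => simpa [inner_add_left] using hx.add hy
    | smul c x _ hx => simpa [inner_smul_left, mul_comm] using hx.const_mul (conj c)
  have hC0 : 0 ≤ C := (norm_nonneg _).trans (hC 0)
  -- `D` bounds the `T n` and also `S`, so `key` controls both outer terms of the ε/3 argument.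
  set D := max C ‖S‖ with hD
  have hD0 : 0 ≤ D := hC0.trans (le_max_left _ _)
  have key : ∀ R : H →L[ℂ] H, ‖R‖ ≤ D → ∀ ξ η ξ' η' : H,
      ‖inner ℂ ξ (R η) - inner ℂ ξ' (R η')‖ ≤ D * (‖ξ‖ * ‖η - η'‖ + ‖ξ - ξ'‖ * ‖η'‖) := by
    intro R hR ξ η ξ' η'
    have e : inner ℂ ξ (R η) - inner ℂ ξ' (R η')
        = inner ℂ ξ (R (η - η')) + inner ℂ (ξ - ξ') (R η') := by
      rw [map_sub, inner_sub_right, inner_sub_left]; ring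
    rw [e]
    calc _ ≤ ‖ξ‖ * ‖R (η - η')‖ + ‖ξ - ξ'‖ * ‖R η'‖ :=
          (norm_add_le _ _).trans (add_le_add (norm_inner_le_norm _ _) (norm_inner_le_norm _ _))
      _ ≤ ‖ξ‖ * (D * ‖η - η'‖) + ‖ξ - ξ'‖ * (D * ‖η'‖) := by
          gcongr <;> exact R.le_of_opNorm_le hR _
      _ = _ := by ring
  intro ξ η
  rw [Metric.tendsto_atTop]
  intro ε hε
  -- The error bound of `key` is continuous in the approximating pair and vanishes at `(ξ, η)`, so
  -- some pair from the dense span makes it smaller than ε/3.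
  have hcont : Tendsto (fun p : H × H => D * (‖ξ‖ * ‖η - p.2‖ + ‖ξ - p.1‖ * ‖p.2‖)) (𝓝 (ξ, η))
      (𝓝 (D * (‖ξ‖ * ‖η - η‖ + ‖ξ - ξ‖ * ‖η‖))) :=
    Continuous.tendsto (by fun_prop) (ξ, η)
  simp only [sub_self, norm_zero, mul_zero, zero_mul, add_zero] at hcont
  obtain ⟨⟨ξ', η'⟩, ⟨hξ', hη'⟩, hlt⟩ := (hs.prod hs).inter_nhds_nonempty
    (hcont.eventually_lt_const (show (0 : ℝ) < ε / 3 by linarith))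
  obtain ⟨N, hN⟩ := Metric.tendsto_atTop.mp (hspan ξ' hξ' η' hη') (ε / 3) (by linarith)
  refine ⟨N, fun n hn => ?_⟩
  have h1 := key (T n) ((hC n).trans (le_max_left _ _)) ξ η ξ' η'
  have h2 := key S (le_max_right _ _) ξ η ξ' η'
  have h3 := hN n hn
  rw [dist_eq_norm] at h3 ⊢
  have e : inner ℂ ξ (T n η) - inner ℂ ξ (S η)
      = (inner ℂ ξ (T n η) - inner ℂ ξ' (T n η')) + (inner ℂ ξ' (T n η') - inner ℂ ξ' (S η'))
        - (inner ℂ ξ (S η) - inner ℂ ξ' (S η')) := by ring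
  rw [e]
  simp only [Set.mem_ofPred_eq] at hlt
  refine (norm_sub_le _ _).trans_lt ?_
  linarith [norm_add_le (inner ℂ ξ (T n η) - inner ℂ ξ' (T n η'))
    (inner ℂ ξ' (T n η') - inner ℂ ξ' (S η'))]

/-! ### Sigma-convergence -/

section SigmaConvergence

variable {A : Type u} [NonUnitalCStarAlgebra A] [SigmaStarAlgebra A]

theorem sigmaConv_star {a : ℕ → A} {a₀ : A} (h : sigmaConv a a₀) :
    sigmaConv (fun n => star (a n)) (star a₀) := by
  obtain ⟨H, _, _, _, π, -, -, -, hπ⟩ := SigmaStarAlgebra.exists_faithful_representation (A := A)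
  rw [hπ, wotConverges_iff] at h ⊢
  intro ξ η
  have := (Complex.continuous_conj.tendsto _).comp (h η ξ)
  simpa only [Function.comp_def, inner_conj_symm, map_star, ContinuousLinearMap.star_eq_adjoint,
    ContinuousLinearMap.adjoint_inner_right] using this

theorem sigmaConv_mul_right {a : ℕ → A} {a₀ : A} (h : sigmaConv a a₀) (c : A) :
    sigmaConv (fun n => a n * c) (a₀ * c) := by
  obtain ⟨H, _, _, _, π, -, -, -, hπ⟩ := SigmaStarAlgebra.exists_faithful_representation (A := A)
  rw [hπ, wotConverges_iff] at h ⊢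
  intro ξ η
  simpa using h ξ (π c η)

/-- WOT-convergent sequences are bounded, and a faithful representation is isometric. The bound is
needed to test convergence on simple tensors in `wotConverges_rep`. -/
theorem exists_norm_le_of_sigmaConv {a : ℕ → A} {a₀ : A} (h : sigmaConv a a₀) :
    ∃ C, ∀ n, ‖a n‖ ≤ C := by
  obtain ⟨H, _, _, _, π, hinj, -, -, hπ⟩ :=
    SigmaStarAlgebra.exists_faithful_representation (A := A)
  obtain ⟨C, hC⟩ := ((hπ _ _).mp h).exists_norm_le
  exact ⟨C, fun n => by simpa [NonUnitalStarAlgHom.norm_map π hinj] using hC n⟩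

/-- A σ-continuous linear functional that vanishes on a set with σ-dense span vanishes. -/
theorem eq_zero_of_sigmaClosure_span {s : Set A}
    (hs : sigmaClosure (Submodule.span ℂ s : Set A) = Set.univ) (φ : A →ₗ[ℂ] ℂ)
    (hφ : ∀ (a : ℕ → A) (a₀ : A), sigmaConv a a₀ →
      Tendsto (fun n => φ (a n)) atTop (𝓝 (φ a₀)))
    (h : ∀ a ∈ s, φ a = 0) (a : A) : φ a = 0 := by
  have ha : a ∈ sigmaClosure (Submodule.span ℂ s : Set A) := hs ▸ Set.mem_univ a
  -- The kernel of `φ` is one of the σ-closed sets whose intersection is the σ-closure, so no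
  -- iteration of sequential limits is required.
  refine ha {a | φ a = 0} ⟨?_, ?_⟩
  · exact Submodule.span_le (p := LinearMap.ker φ).mpr fun a ha => h a ha
  · intro b b₀ hb hconv
    refine tendsto_nhds_unique (hφ b b₀ hconv) ?_
    have : (fun n => φ (b n)) = fun _ => 0 := funext hb
    rw [this]
    exact tendsto_const_nhds

/-- If `c * b = 0` for all `c` in a set with σ-dense span, then `b = 0`. -/
theorem eq_zero_of_forall_mul_eq_zero {s : Set A}
    (hs : sigmaClosure (Submodule.span ℂ s : Set A) = Set.univ) (b : A)
    (h : ∀ c ∈ s, c * b = 0) : b = 0 := by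
  obtain ⟨H, _, _, _, π, hinj, -, -, hπ⟩ :=
    SigmaStarAlgebra.exists_faithful_representation (A := A)
  have key : ∀ c : A, c * b = 0 := by
    intro c
    refine hinj (ContinuousLinearMap.ext fun η => ext_inner_left ℂ fun ξ => ?_)
    rw [map_zero, zero_apply, inner_zero_right]
    -- The functional `c ↦ ⟨ξ, π(c b) η⟩` is σ-continuous because right multiplication is.
    refine eq_zero_of_sigmaClosure_span hs
      { toFun := fun c => inner ℂ ξ (π (c * b) η)
        map_add' := fun x y => by simp [add_mul]
        map_smul' := fun z x => by simp } ?_ ?_ c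
    · intro a a₀ ha
      exact wotConverges_iff.mp ((hπ _ _).mp (sigmaConv_mul_right ha b)) ξ η
    · intro c hc
      change inner ℂ ξ (π (c * b) η) = 0
      rw [h c hc, map_zero, zero_apply, inner_zero_right]
  -- Here `c = star b`.
  exact (CStarRing.star_mul_self_eq_zero_iff b).mp (key _)

end SigmaConvergence

/-! ### Operators on Hilbert spaces -/

section Operators

variable {ι M N : Type*} [NormedAddCommGroup M] [InnerProductSpace ℂ M]
  [NormedAddCommGroup N] [InnerProductSpace ℂ N]

theorem denseRange_linearCombination {f : ι → M}
    (hf : Dense (Submodule.span ℂ (Set.range f) : Set M)) :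
    DenseRange (Finsupp.linearCombination ℂ f) := by
  rw [DenseRange, ← LinearMap.coe_range, Finsupp.range_linearCombination]
  exact hf

/-- Two families of vectors with the same Gram matrix and dense spans are related by a unitary. -/
theorem exists_unitary_of_inner_eq [CompleteSpace M] [CompleteSpace N] {f : ι → M} {g : ι → N}
    (hf : Dense (Submodule.span ℂ (Set.range f) : Set M))
    (hg : Dense (Submodule.span ℂ (Set.range g) : Set N))
    (h : ∀ i j, inner ℂ (f i) (f j) = inner ℂ (g i) (g j)) :
    ∃ U : M ≃ₗᵢ[ℂ] N, ∀ i, U (f i) = g i := by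
  have hnorm : ∀ c : ι →₀ ℂ,
      ‖Finsupp.linearCombination ℂ f c‖ = ‖Finsupp.linearCombination ℂ g c‖ := by
    intro c
    rw [← sq_eq_sq₀ (norm_nonneg _) (norm_nonneg _), ← inner_self_eq_norm_sq (𝕜 := ℂ),
      ← inner_self_eq_norm_sq (𝕜 := ℂ)]
    simp only [Finsupp.linearCombination_apply, Finsupp.sum, sum_inner, inner_sum,
      inner_smul_left, inner_smul_right, h]
  have hdf := denseRange_linearCombination hf
  have hdg := denseRange_linearCombination hg
  -- By `hnorm`, the finitely supported functions carry the same seminorm through `f` and through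
  -- `g`; the identity on them therefore extends, with constant 1 in both directions.
  let V : M ≃L[ℂ] N := (LinearEquiv.refl ℂ (ι →₀ ℂ)).extend (Finsupp.linearCombination ℂ f)
    (Finsupp.linearCombination ℂ g) hdf ⟨1, fun x => by simp [hnorm]⟩ hdg
    ⟨1, fun x => by simp [hnorm]⟩
  have hV : ∀ c, V (Finsupp.linearCombination ℂ f c) = Finsupp.linearCombination ℂ g c :=
    fun c => LinearEquiv.extend_eq _ _ _ _ _ _ _ c
  refine ⟨⟨V.toLinearEquiv, fun x => ?_⟩, fun i => ?_⟩
  · refine hdf.induction_on (p := fun x => ‖V x‖ = ‖x‖) x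
      (isClosed_eq (by fun_prop) (by fun_prop)) fun c => ?_
    rw [hV, hnorm]
  · simpa using hV (Finsupp.single i 1)

/-- Bounded operators that agree on a family with dense span are equal. -/
theorem clm_ext_of_dense_span {f : ι → M}
    (hf : Dense (Submodule.span ℂ (Set.range f) : Set M)) {S T : M →L[ℂ] N}
    (h : ∀ i, S (f i) = T (f i)) : S = T :=
  ContinuousLinearMap.ext_on hf (by rintro _ ⟨i, rfl⟩; exact h i)

theorem eq_zero_of_dense_span {f : ι → M}
    (hf : Dense (Submodule.span ℂ (Set.range f) : Set M)) {v : M}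
    (h : ∀ i, inner ℂ (f i) v = 0) : v = 0 := by
  refine hf.eq_zero_of_inner_right (𝕜 := ℂ) fun x hx => ?_
  induction hx using Submodule.span_induction with
  | mem x hx => obtain ⟨i, rfl⟩ := hx; exact h i
  | zero => simp
  | add x y _ _ hx hy => simp [inner_add_left, hx, hy]
  | smul c x _ hx => simp [inner_smul_left, hx]

theorem dense_span_of_forall_inner_eq_zero [CompleteSpace M] {s : Set M}
    (h : ∀ v : M, (∀ x ∈ s, inner ℂ x v = 0) → v = 0) :
    Dense (Submodule.span ℂ s : Set M) := by
  rw [Submodule.dense_iff_topologicalClosure_eq_top, Submodule.topologicalClosure_eq_top_iff,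
    Submodule.eq_bot_iff]
  intro v hv
  exact h v fun x hx => (Submodule.mem_orthogonal _ _).mp hv x (Submodule.subset_span hx)

end Operators

/-! ### Automatic contractivity of adjoint-preserving actions -/

section BoundedRepresentation

attribute [local instance] CStarAlgebra.spectralOrder CStarAlgebra.spectralOrderedRing

/-- An adjoint-preserving action of a C*-algebra on a space with a semi-inner product is
contractive. -/
theorem norm_apply_le_of_adjoint {A D : Type*} [NonUnitalCStarAlgebra A]
    [SeminormedAddCommGroup D] [InnerProductSpace ℂ D] (T : A →ₙₐ[ℂ] Module.End ℂ D)
    (hT : ∀ (a : A) (s t : D), inner ℂ (T a s) t = inner ℂ s (T (star a) t)) (a : A) (t : D) :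
    ‖T a t‖ ≤ ‖a‖ * ‖t‖ := by
  -- In the unitization `‖a‖² - a*a` is positive, hence of the form `c*c`. Applying the action gives
  -- `‖a‖²‖t‖² - ‖a t‖² = ‖c t‖² ≥ 0`, with no boundedness assumed beforehand.
  let S : Unitization ℂ A →ₐ[ℂ] Module.End ℂ D := Unitization.lift T
  have hS : ∀ (u : Unitization ℂ A) (s t : D), inner ℂ (S u s) t = inner ℂ s (S (star u) t) := by
    intro u s t
    induction u using Unitization.ind with
    | inl_add_inr z a =>
      simp [S, hT, inner_add_left, inner_add_right, inner_smul_left, inner_smul_right,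
        Algebra.algebraMap_eq_smul_one]
  have hle := CStarAlgebra.star_mul_le_algebraMap_norm_sq (a := (a : Unitization ℂ A))
  obtain ⟨c, hc⟩ := CStarAlgebra.nonneg_iff_eq_star_mul_self.mp (sub_nonneg.mpr hle)
  have h1 : inner ℂ (S c t) (S c t)
      = (‖a‖ ^ 2 : ℂ) * inner ℂ t t - inner ℂ (T a t) (T a t) := by
    have hSa : S (a : Unitization ℂ A) = T a := by simp [S]
    rw [hS, ← Module.End.mul_apply, ← map_mul, ← hc, ← hSa, hS, ← Module.End.mul_apply, ← map_mul,
      map_sub, LinearMap.sub_apply, inner_sub_right, ← inner_smul_right, Unitization.norm_inr]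
    congr 3
    rw [IsScalarTower.algebraMap_apply ℝ ℂ (Unitization ℂ A), AlgHom.commutes,
      Module.algebraMap_end_apply]
    simp
  have h2 := congrArg Complex.re h1
  have e1 : ∀ x : D, inner ℂ x x = ((‖x‖ ^ 2 : ℝ) : ℂ) := fun x => by
    rw [inner_self_eq_norm_sq_to_K]; simp
  rw [e1, e1, e1] at h2
  norm_cast at h2
  refine le_of_sq_le_sq ?_ (by positivity)
  rw [mul_pow]
  linarith [sq_nonneg ‖S c t‖]

end BoundedRepresentation

/-! ### Operators on interior tensor products -/

section InteriorTensorOperators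

variable {B : Type*} {E : Type*} {K L : Type*} [NonUnitalCStarAlgebra B] [PartialOrder B]
  [StarOrderedRing B] [AddCommGroup E] [Module ℂ E] [RightCStarModule B E]
  [NormedAddCommGroup K] [InnerProductSpace ℂ K] [CompleteSpace K]
  [NormedAddCommGroup L] [InnerProductSpace ℂ L] [CompleteSpace L]
  (π : B →⋆ₙₐ[ℂ] (K →L[ℂ] K)) (ρ : B →⋆ₙₐ[ℂ] (L →L[ℂ] L))

theorem preTmul_induction {p : PreTensor E π → Prop} (zero : p 0)
    (add : ∀ s t, p s → p t → p (s + t)) (tmul : ∀ x ζ, p (preTmul π x ζ)) (t : PreTensor E π) :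
    p t :=
  TensorProduct.induction_on (motive := p) t zero tmul add

theorem preTensor_linearMap_ext {S T : Module.End ℂ (PreTensor E π)}
    (hST : ∀ x ζ, S (preTmul π x ζ) = T (preTmul π x ζ)) : S = T :=
  TensorProduct.ext' (M := E) (N := K) hST

theorem simpleTensor_add (x y : E) (ζ : K) :
    simpleTensor π (x + y) ζ = simpleTensor π x ζ + simpleTensor π y ζ := by
  rw [simpleTensor, simpleTensor, simpleTensor, ← Completion.coe_add]
  exact congrArg _ (TensorProduct.add_tmul x y ζ)

theorem simpleTensor_smul (z : ℂ) (x : E) (ζ : K) :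
    simpleTensor π (z • x) ζ = z • simpleTensor π x ζ := by
  rw [simpleTensor, simpleTensor, ← Completion.coe_smul]
  exact congrArg _ (TensorProduct.smul_tmul' z x ζ).symm

theorem dense_span_simpleTensor :
    Dense (Submodule.span ℂ (Set.range fun p : E × K => simpleTensor π p.1 p.2) :
      Set (InteriorTensor E π)) := by
  refine dense_span_of_forall_inner_eq_zero fun v hv => ?_
  refine Completion.denseRange_coe.eq_zero_of_inner_right ℂ fun t => ?_
  induction t using preTmul_induction with
  | zero => rw [Completion.coe_zero, inner_zero_left]
  | add s t hs ht => rw [Completion.coe_add, inner_add_left, hs, ht, add_zero]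
  | tmul x ζ => exact hv _ ⟨(x, ζ), rfl⟩

/-- The creation operator `ζ ↦ x ⊗ ζ`. -/
noncomputable def creation (x : E) : K →L[ℂ] InteriorTensor E π :=
  LinearMap.mkContinuous
    { toFun := simpleTensor π x
      map_add' := fun ζ η => by
        rw [simpleTensor, simpleTensor, simpleTensor, ← Completion.coe_add]
        exact congrArg _ (TensorProduct.tmul_add x ζ η)
      map_smul' := fun c ζ => by
        rw [simpleTensor, simpleTensor, RingHom.id_apply, ← Completion.coe_smul]
        exact congrArg _ (TensorProduct.tmul_smul c x ζ) }
    -- The constant comes from `‖x ⊗ ζ‖² = ⟨ζ, π(⟨x|x⟩) ζ⟩`.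
    √‖π (rightInner x x)‖ fun ζ => by
      change ‖simpleTensor π x ζ‖ ≤ _
      refine le_of_sq_le_sq ?_ (by positivity)
      rw [mul_pow, Real.sq_sqrt (norm_nonneg _), ← inner_self_eq_norm_sq (𝕜 := ℂ),
        inner_simpleTensor]
      calc RCLike.re (inner ℂ ζ (π (rightInner x x) ζ)) ≤ ‖ζ‖ * ‖π (rightInner x x) ζ‖ :=
            (RCLike.re_le_norm _).trans (norm_inner_le_norm _ _)
        _ ≤ ‖ζ‖ * (‖π (rightInner x x)‖ * ‖ζ‖) := by gcongr; exact ContinuousLinearMap.le_opNorm _ _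
        _ = _ := by ring

theorem creation_apply (x : E) (ζ : K) : creation π x ζ = simpleTensor π x ζ := rfl

/-- The difference of the two sides is orthogonal to every simple tensor, so separation makes the
tensor product balanced over `B`. -/
theorem simpleTensor_rightAct (x : E) (b : B) (ζ : K) :
    simpleTensor π (rightAct x b) ζ = simpleTensor π x (π b ζ) := by
  rw [← sub_eq_zero]
  refine eq_zero_of_dense_span (dense_span_simpleTensor π) fun p => ?_
  rw [inner_sub_right, inner_simpleTensor, inner_simpleTensor,
    RightCStarModule.rightInner_rightAct, map_mul, mul_apply_eq_comp, sub_self]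

/-- The span of the simple tensors with second factor in a family with dense span is dense. -/
theorem dense_span_simpleTensor_of_dense_span {ι : Type*} {f : ι → K}
    (hf : Dense (Submodule.span ℂ (Set.range f) : Set K)) :
    Dense (Submodule.span ℂ (Set.range fun p : E × ι => simpleTensor π p.1 (f p.2)) :
      Set (InteriorTensor E π)) := by
  refine dense_span_of_forall_inner_eq_zero fun v hv => ?_
  -- The adjoint of the creation operator moves orthogonality from `E ⊗ K` to `K`, where the density
  -- of the given family applies.
  have key : ∀ x : E, ContinuousLinearMap.adjoint (creation π x) v = 0 := fun x =>
    eq_zero_of_dense_span hf fun i => by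
      rw [ContinuousLinearMap.adjoint_inner_right]
      exact hv _ ⟨(x, i), rfl⟩
  refine eq_zero_of_dense_span (dense_span_simpleTensor π) fun p => ?_
  rw [← creation_apply, ← ContinuousLinearMap.adjoint_inner_right, key, inner_zero_right]

variable {π ρ}

/-- A bounded linear map between algebraic tensor products extends to the interior tensor
products. -/
theorem exists_clm_extending {E' : Type*} {B' : Type*} [NonUnitalCStarAlgebra B'] [PartialOrder B']
    [StarOrderedRing B'] [AddCommGroup E'] [Module ℂ E'] [RightCStarModule B' E']
    {ρ : B' →⋆ₙₐ[ℂ] (L →L[ℂ] L)} (T : PreTensor E π →ₗ[ℂ] PreTensor E' ρ) (C : ℝ)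
    (hT : ∀ t, ‖T t‖ ≤ C * ‖t‖) :
    ∃ S : InteriorTensor E π →L[ℂ] InteriorTensor E' ρ,
      ∀ t : PreTensor E π, S (t : Completion (PreTensor E π)) = (T t : Completion (PreTensor E' ρ)) :=
  ⟨_, LinearMap.extendOfNorm_eq
    (f := (Completion.toComplL (𝕜 := ℂ) (E := PreTensor E' ρ)).toLinearMap ∘ₗ T)
    (e := (Completion.toComplL (𝕜 := ℂ) (E := PreTensor E π)).toLinearMap)
    Completion.denseRange_coe
    ⟨C, fun t => by
      change ‖(T t : Completion (PreTensor E' ρ))‖ ≤ C * ‖(t : Completion (PreTensor E π))‖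
      rw [Completion.norm_coe, Completion.norm_coe]
      exact hT t⟩⟩

/-- The Gram matrix is positive, since `∑ cᵢ*⟨xᵢ|xⱼ⟩cⱼ` is the inner product of `∑ xᵢcᵢ` with
itself; hence it equals `N*N`. -/
theorem exists_gram_factorization {k : ℕ} (x : Fin k → E) :
    ∃ N : Fin k → Fin k → B, ∀ i j, (rightInner (x i) (x j) : B) = ∑ l, star (N l i) * N l j := by
  obtain ⟨N, hN⟩ := exists_matrix_eq_star_mul_self
    (CStarMatrix.ofMatrix fun i j => (rightInner (x i) (x j) : B))
    (CStarMatrix.ext fun i j => RightCStarModule.star_rightInner (x j) (x i))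
    (fun c => by
      have h := RightCStarModule.rightInner_self_nonneg (B := B) (∑ i, rightAct (x i) (c i))
      rw [rightInner_sum_left] at h
      refine h.trans_eq (Finset.sum_congr rfl fun i _ => ?_)
      rw [rightInner_sum_right]
      refine Finset.sum_congr rfl fun j _ => ?_
      rw [RightCStarModule.rightInner_rightAct, rightInner_rightAct_left]
      rfl)
  refine ⟨fun l i => N l i, fun i j => ?_⟩
  have := congrArg (fun M : CStarMatrix (Fin k) (Fin k) B => M i j) hN
  rw [CStarMatrix.mul_apply] at this
  exact this

/-- This writes the norm of a tensor through norms of vectors in `K`. As `N` depends on the `x i`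
alone, the same `N` serves for every representation of `B`. -/
theorem norm_sq_sum_preTmul {k : ℕ} (x : Fin k → E) (N : Fin k → Fin k → B)
    (hN : ∀ i j, (rightInner (x i) (x j) : B) = ∑ l, star (N l i) * N l j) (ζ : Fin k → K) :
    ‖(∑ i, preTmul π (x i) (ζ i) : PreTensor E π)‖ ^ 2 = ∑ l, ‖∑ i, π (N l i) (ζ i)‖ ^ 2 := by
  have key : (inner ℂ (∑ i, preTmul π (x i) (ζ i)) (∑ i, preTmul π (x i) (ζ i)) : ℂ)
      = ∑ l, inner ℂ (∑ i, π (N l i) (ζ i)) (∑ j, π (N l j) (ζ j)) := by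
    have e : ∀ i j, (inner ℂ (preTmul π (x i) (ζ i)) (preTmul π (x j) (ζ j)) : ℂ)
        = inner ℂ (ζ i) (π (rightInner (x i) (x j)) (ζ j)) := fun i j => rfl
    simp only [sum_inner, inner_sum, e, hN, map_sum, map_mul,
      map_star, sum_apply, mul_apply_eq_comp,
      ContinuousLinearMap.star_eq_adjoint, ContinuousLinearMap.adjoint_inner_right]
    rw [Finset.sum_comm]
    conv_rhs => rw [Finset.sum_comm]
    conv_rhs => enter [2, i]; rw [Finset.sum_comm]
    rw [Finset.sum_comm]
  rw [← inner_self_eq_norm_sq (𝕜 := ℂ), key, map_sum]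
  exact Finset.sum_congr rfl fun l _ => inner_self_eq_norm_sq _

/-- The operator `id ⊗ T` on the algebraic tensor products. -/
def preMap (T : K →L[ℂ] L) : PreTensor E π →ₗ[ℂ] PreTensor E ρ :=
  (TensorProduct.map LinearMap.id T.toLinearMap : E ⊗[ℂ] K →ₗ[ℂ] E ⊗[ℂ] L)

theorem preMap_preTmul (T : K →L[ℂ] L) (x : E) (ζ : K) :
    preMap (π := π) (ρ := ρ) T (preTmul π x ζ) = preTmul ρ x (T ζ) := rfl

/-- With a common `N` for both representations, the module map `T` passes through each `∑ π(N l i)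
ζᵢ`, and the estimate holds summand by summand. -/
theorem norm_preMap_le (T : K →L[ℂ] L) (hT : ∀ (b : B) (ζ : K), T (π b ζ) = ρ b (T ζ))
    (t : PreTensor E π) : ‖preMap (ρ := ρ) T t‖ ≤ ‖T‖ * ‖t‖ := by
  obtain ⟨k, x, ζ, ht⟩ := TensorProduct.exists_sum_tmul_eq (R := ℂ) (M := E) (N := K) t
  obtain rfl : t = ∑ i, preTmul π (x i) (ζ i) := ht
  obtain ⟨N, hN⟩ := exists_gram_factorization (B := B) x
  refine le_of_sq_le_sq ?_ (by positivity)
  rw [map_sum, mul_pow]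
  simp only [preMap_preTmul]
  rw [norm_sq_sum_preTmul x N hN, norm_sq_sum_preTmul x N hN, Finset.mul_sum]
  refine Finset.sum_le_sum fun l _ => ?_
  simp only [← hT, ← map_sum]
  rw [← mul_pow]
  exact pow_le_pow_left₀ (norm_nonneg _) (T.le_opNorm _) 2

theorem exists_tensorMap (T : K →L[ℂ] L) (hT : ∀ (b : B) (ζ : K), T (π b ζ) = ρ b (T ζ)) :
    ∃ S : InteriorTensor E π →L[ℂ] InteriorTensor E ρ,
      ∀ (x : E) (ζ : K), S (simpleTensor π x ζ) = simpleTensor ρ x (T ζ) := by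
  obtain ⟨S, hS⟩ := exists_clm_extending (preMap (E := E) (π := π) (ρ := ρ) T) ‖T‖
    (norm_preMap_le T hT)
  exact ⟨S, fun x ζ => hS _⟩

/-- The operator `id ⊗ T` for a module map `T`. -/
noncomputable def tensorMap (T : K →L[ℂ] L) (hT : ∀ (b : B) (ζ : K), T (π b ζ) = ρ b (T ζ)) :
    InteriorTensor E π →L[ℂ] InteriorTensor E ρ :=
  (exists_tensorMap T hT).choose

theorem tensorMap_simpleTensor (T : K →L[ℂ] L) (hT : ∀ (b : B) (ζ : K), T (π b ζ) = ρ b (T ζ))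
    (x : E) (ζ : K) : tensorMap T hT (simpleTensor π x ζ) = simpleTensor ρ x (T ζ) :=
  (exists_tensorMap T hT).choose_spec x ζ

theorem tensorMap_adjoint (T : K →L[ℂ] L) (hT : ∀ (b : B) (ζ : K), T (π b ζ) = ρ b (T ζ))
    (hT' : ∀ (b : B) (ζ : L), ContinuousLinearMap.adjoint T (ρ b ζ)
      = π b (ContinuousLinearMap.adjoint T ζ)) :
    tensorMap (E := E) (ContinuousLinearMap.adjoint T) hT'
      = ContinuousLinearMap.adjoint (tensorMap T hT) := by
  refine clm_ext_of_dense_span (dense_span_simpleTensor ρ) fun q => ?_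
  rw [← sub_eq_zero]
  refine eq_zero_of_dense_span (dense_span_simpleTensor π) fun p => ?_
  rw [inner_sub_right, ContinuousLinearMap.adjoint_inner_right, tensorMap_simpleTensor,
    tensorMap_simpleTensor, inner_simpleTensor, inner_simpleTensor, ← hT',
    ContinuousLinearMap.adjoint_inner_right, sub_self]

end InteriorTensorOperators

/-! ### Correspondences -/

/-- A right C*-module `E` over `B` with an adjointable, σ-continuous left action of `A` which
induces a functor from the Σ*-Hilbert `B`-modules to the Σ*-Hilbert `A`-modules. -/
structure IsSigmaCorrespondence (A : Type u₁) (B : Type u₂) {E : Type v}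
    [NonUnitalCStarAlgebra A] [SigmaStarAlgebra A]
    [NonUnitalCStarAlgebra B] [PartialOrder B] [StarOrderedRing B] [SigmaStarAlgebra B]
    [AddCommGroup E] [Module ℂ E] [RightCStarModule B E] (act : A → E → E) : Prop where
  act_add : ∀ a x y, act a (x + y) = act a x + act a y
  add_act : ∀ a c x, act (a + c) x = act a x + act c x
  mul_act : ∀ a c x, act (a * c) x = act a (act c x)
  act_smul : ∀ (z : ℂ) a x, act a (z • x) = z • act a x
  smul_act : ∀ (z : ℂ) a x, act (z • a) x = z • act a x
  rightInner_act : ∀ a x y, (rightInner (act a x) y : B) = rightInner x (act (star a) y)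
  sigmaConv_act : ∀ (a : ℕ → A) (a₀ : A), sigmaConv a a₀ → ∀ x y : E,
    sigmaConv (fun n => (rightInner x (act (a n) y) : B)) (rightInner x (act a₀ y))
  -- In a bimodule `a` is the left inner product of `x` and `y`. Only its existence is needed, for
  -- nondegeneracy of the representation on `E ⊗ K`.
  exists_act_eq : ∀ x y z : E, ∃ a, act a z = rightAct x (rightInner y z : B)
  full : IsRightSigmaFull B E

namespace IsSigmaCorrespondence

/-! ### The representation of `A` on `E ⊗ K` -/

section Representation

variable {A : Type u₁} {B : Type u₂} {E : Type v}
    [NonUnitalCStarAlgebra A] [SigmaStarAlgebra A]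
    [NonUnitalCStarAlgebra B] [PartialOrder B] [StarOrderedRing B] [SigmaStarAlgebra B]
    [AddCommGroup E] [Module ℂ E] [RightCStarModule B E] {act : A → E → E}
    (h : IsSigmaCorrespondence A B act)
    {K : Type*} [NormedAddCommGroup K] [InnerProductSpace ℂ K] [CompleteSpace K]
    (π : B →⋆ₙₐ[ℂ] (K →L[ℂ] K))

/-- The action of `a` as a linear map. -/
def actLinear (a : A) : E →ₗ[ℂ] E where
  toFun := act a
  map_add' := h.act_add a
  map_smul' z x := h.act_smul z a x

/-- The operator `a ⊗ id` on the algebraic tensor product. -/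
def preActLinear (a : A) : Module.End ℂ (PreTensor E π) :=
  (TensorProduct.map (h.actLinear a) LinearMap.id : E ⊗[ℂ] K →ₗ[ℂ] E ⊗[ℂ] K)

theorem preActLinear_preTmul (a : A) (x : E) (ζ : K) :
    h.preActLinear π a (preTmul π x ζ) = preTmul π (act a x) ζ := rfl

/-- The action of `A` on the algebraic tensor product. -/
def preAct : A →ₙₐ[ℂ] Module.End ℂ (PreTensor E π) where
  toFun := h.preActLinear π
  map_smul' z a := preTensor_linearMap_ext π fun x ζ => by
    rw [preActLinear_preTmul, h.smul_act]
    rfl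
  map_zero' := preTensor_linearMap_ext π fun x ζ => by
    rw [preActLinear_preTmul, ← zero_smul ℂ (0 : A), h.smul_act, zero_smul]
    exact TensorProduct.zero_tmul _ _
  map_add' a c := preTensor_linearMap_ext π fun x ζ => by
    rw [preActLinear_preTmul, h.add_act]
    exact TensorProduct.add_tmul _ _ _
  map_mul' a c := preTensor_linearMap_ext π fun x ζ => by
    rw [preActLinear_preTmul, h.mul_act]
    rfl

theorem preAct_preTmul (a : A) (x : E) (ζ : K) :
    h.preAct π a (preTmul π x ζ) = preTmul π (act a x) ζ := rfl

theorem inner_preAct (a : A) (s t : PreTensor E π) :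
    inner ℂ (h.preAct π a s) t = inner ℂ s (h.preAct π (star a) t) := by
  induction s using preTmul_induction with
  | zero => simp
  | add s s' hs hs' => rw [map_add, inner_add_left, inner_add_left, hs, hs']
  | tmul x ζ =>
    induction t using preTmul_induction with
    | zero => simp
    | add t t' ht ht' => rw [map_add, inner_add_right, inner_add_right, ht, ht']
    | tmul y η =>
      rw [preAct_preTmul, preAct_preTmul]
      exact congrArg (fun b => inner ℂ ζ (π b η)) (h.rightInner_act a x y)

theorem exists_repCLM (h : IsSigmaCorrespondence A B act) (a : A) : ∃ S : InteriorTensor E π →L[ℂ] InteriorTensor E π,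
    ∀ (x : E) (ζ : K), S (simpleTensor π x ζ) = simpleTensor π (act a x) ζ := by
  obtain ⟨S, hS⟩ := exists_clm_extending (h.preAct π a) ‖a‖
    (norm_apply_le_of_adjoint (h.preAct π) (h.inner_preAct π) a)
  exact ⟨S, fun x ζ => hS _⟩

/-- The operator `a ⊗ id` on the interior tensor product. -/
noncomputable def repCLM (a : A) : InteriorTensor E π →L[ℂ] InteriorTensor E π :=
  (h.exists_repCLM π a).choose

theorem repCLM_simpleTensor (a : A) (x : E) (ζ : K) :
    h.repCLM π a (simpleTensor π x ζ) = simpleTensor π (act a x) ζ :=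
  (h.exists_repCLM π a).choose_spec x ζ

/-- The representation of `A` on the interior tensor product. -/
noncomputable def rep : A →⋆ₙₐ[ℂ] (InteriorTensor E π →L[ℂ] InteriorTensor E π) where
  toFun := h.repCLM π
  map_smul' z a := clm_ext_of_dense_span (dense_span_simpleTensor π) fun p => by
    simp [repCLM_simpleTensor, h.smul_act, simpleTensor_smul]
  map_zero' := clm_ext_of_dense_span (dense_span_simpleTensor π) fun p => by
    rw [repCLM_simpleTensor, ← zero_smul ℂ (0 : A), h.smul_act, simpleTensor_smul, zero_smul,
      zero_apply]
  map_add' a c := clm_ext_of_dense_span (dense_span_simpleTensor π) fun p => by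
    simp [repCLM_simpleTensor, h.add_act, simpleTensor_add]
  map_mul' a c := clm_ext_of_dense_span (dense_span_simpleTensor π) fun p => by
    simp [repCLM_simpleTensor, h.mul_act]
  map_star' a := clm_ext_of_dense_span (dense_span_simpleTensor π) fun p => by
    rw [← sub_eq_zero]
    refine eq_zero_of_dense_span (dense_span_simpleTensor π) fun q => ?_
    rw [inner_sub_right, ContinuousLinearMap.star_eq_adjoint,
      ContinuousLinearMap.adjoint_inner_right, repCLM_simpleTensor, repCLM_simpleTensor,
      inner_simpleTensor, inner_simpleTensor, h.rightInner_act, sub_self]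

theorem rep_simpleTensor (a : A) (x : E) (ζ : K) :
    h.rep π a (simpleTensor π x ζ) = simpleTensor π (act a x) ζ :=
  h.repCLM_simpleTensor π a x ζ

theorem tensorMap_rep {L : Type*} [NormedAddCommGroup L] [InnerProductSpace ℂ L] [CompleteSpace L]
    {π : B →⋆ₙₐ[ℂ] (K →L[ℂ] K)} {ρ : B →⋆ₙₐ[ℂ] (L →L[ℂ] L)} (T : K →L[ℂ] L)
    (hT : ∀ (b : B) (ζ : K), T (π b ζ) = ρ b (T ζ)) (a : A) (ξ : InteriorTensor E π) :
    tensorMap T hT (h.rep π a ξ) = h.rep ρ a (tensorMap T hT ξ) := by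
  have : (tensorMap T hT).comp (h.rep π a) = (h.rep ρ a).comp (tensorMap T hT) :=
    clm_ext_of_dense_span (dense_span_simpleTensor π) fun p => by
      simp only [ContinuousLinearMap.comp_apply, rep_simpleTensor, tensorMap_simpleTensor]
  exact congrArg (fun S : InteriorTensor E π →L[ℂ] InteriorTensor E ρ => S ξ) this

end Representation

end IsSigmaCorrespondence

/-- In a Σ*-Hilbert module, a vector orthogonal to all `π a ζ`, with `a` from a set with σ-dense
span, is zero. -/
theorem SigmaHilbertModule.inner_rep_eq_zero {A : Type u} [NonUnitalCStarAlgebra A]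
    [SigmaStarAlgebra A] (K : SigmaHilbertModule.{u, w} A) {s : Set A}
    (hs : sigmaClosure (Submodule.span ℂ s : Set A) = Set.univ) {v ζ : K.carrier}
    (h : ∀ a ∈ s, inner ℂ v (K.rep a ζ) = 0) (a : A) : inner ℂ v (K.rep a ζ) = 0 :=
  eq_zero_of_sigmaClosure_span hs
    { toFun := fun a => inner ℂ v (K.rep a ζ)
      map_add' := fun x y => by simp
      map_smul' := fun z x => by simp }
    (fun _ _ ha => wotConverges_iff.mp (K.sigma_continuous _ _ ha) v ζ) h a

theorem SigmaHilbertModule.eq_zero_of_inner_rep {A : Type u} [NonUnitalCStarAlgebra A]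
    [SigmaStarAlgebra A] (K : SigmaHilbertModule.{u, w} A) {v : K.carrier}
    (h : ∀ a ζ, inner ℂ v (K.rep a ζ) = 0) : v = 0 := by
  refine eq_zero_of_dense_span (f := fun p : A × K.carrier => K.rep p.1 p.2) ?_ fun p => ?_
  · have : (Set.range fun p : A × K.carrier => K.rep p.1 p.2)
        = {η | ∃ (a : A) (ζ : K.carrier), K.rep a ζ = η} := by
      ext η
      simp
    rw [this]
    exact K.nondegenerate
  · rw [← inner_conj_symm, h, map_zero]

theorem SigmaHilbertModule.toCLM_rep {A : Type u} [NonUnitalCStarAlgebra A]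
    [SigmaStarAlgebra A] {H K : SigmaHilbertModule.{u, w} A} (T : H ⟶ K) (a : A) (ξ : H.carrier) :
    toCLM T (H.rep a ξ) = K.rep a (toCLM T ξ) :=
  T.map_rep a ξ

namespace IsSigmaCorrespondence

/-! ### The tensor functor of a correspondence -/

section Functor

variable {A : Type u₁} {B : Type u₂} {E : Type v}
  [NonUnitalCStarAlgebra A] [SigmaStarAlgebra A]
  [NonUnitalCStarAlgebra B] [PartialOrder B] [StarOrderedRing B] [SigmaStarAlgebra B]
  [AddCommGroup E] [Module ℂ E] [RightCStarModule B E] {act : A → E → E}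
  (h : IsSigmaCorrespondence A B act)

/-- The vector `x ⊗ π(⟨y|z⟩)ζ = x⟨y|z⟩ ⊗ ζ = a z ⊗ ζ` lies in the range of the action. If `v` is
orthogonal to that range, σ-fullness makes it orthogonal to all `x ⊗ π(b)ζ`, and nondegeneracy of
`K` to all simple tensors. -/
theorem nondegenerate_rep (K : SigmaHilbertModule.{u₂, w} B) : Nondegenerate (h.rep K.rep) := by
  refine dense_span_of_forall_inner_eq_zero fun v hv => ?_
  refine eq_zero_of_dense_span (dense_span_simpleTensor K.rep) fun p => ?_
  obtain ⟨x, η⟩ := p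
  have key : ContinuousLinearMap.adjoint (creation K.rep x) v = 0 := by
    refine K.eq_zero_of_inner_rep fun b ζ => ?_
    refine K.inner_rep_eq_zero h.full ?_ b
    rintro _ ⟨y, z, rfl⟩
    obtain ⟨a, ha⟩ := h.exists_act_eq x y z
    rw [ContinuousLinearMap.adjoint_inner_left, creation_apply, ← simpleTensor_rightAct, ← ha,
      ← h.rep_simpleTensor, ← inner_conj_symm, hv _ ⟨a, _, rfl⟩, map_zero]
  change inner ℂ (simpleTensor K.rep x η) v = 0
  rw [← creation_apply, ← ContinuousLinearMap.adjoint_inner_right, key, inner_zero_right]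

theorem wotConverges_rep (K : SigmaHilbertModule.{u₂, w} B) (a : ℕ → A) (a₀ : A)
    (ha : sigmaConv a a₀) : WOTConverges (fun n => h.rep K.rep (a n)) (h.rep K.rep a₀) := by
  obtain ⟨C, hC⟩ := exists_norm_le_of_sigmaConv ha
  refine wotConverges_of_dense_span
    (fun n => (NonUnitalStarAlgHom.norm_apply_le (h.rep K.rep) (a n)).trans (hC n))
    (dense_span_simpleTensor K.rep) ?_
  rintro _ ⟨⟨x, ζ⟩, rfl⟩ _ ⟨⟨y, η⟩, rfl⟩
  simp only [rep_simpleTensor, inner_simpleTensor]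
  exact wotConverges_iff.mp (K.sigma_continuous _ _ (h.sigmaConv_act a a₀ ha x y)) ζ η

/-- The Σ*-Hilbert `A`-module `E ⊗ K`. -/
noncomputable def tensorObj (K : SigmaHilbertModule.{u₂, max v w} B) :
    SigmaHilbertModule.{u₁, max v w} A where
  -- This space lives in universe `max v w`; taking all Hilbert modules there lets the functors be
  -- composed in both orders.
  carrier := InteriorTensor E K.rep
  rep := h.rep K.rep
  nondegenerate := h.nondegenerate_rep K
  sigma_continuous := h.wotConverges_rep K

/-- The module map `id ⊗ T`. -/
noncomputable def tensorHom {K L : SigmaHilbertModule.{u₂, max v w} B} (T : K ⟶ L) :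
    tensorObj.{u₁, u₂, v, w} h K ⟶ tensorObj.{u₁, u₂, v, w} h L :=
  SigmaHilbertModule.Hom.mk (H := tensorObj.{u₁, u₂, v, w} h K)
    (K := tensorObj.{u₁, u₂, v, w} h L)
    (tensorMap (E := E) (toCLM T) (SigmaHilbertModule.toCLM_rep T))
    (h.tensorMap_rep (toCLM T) (SigmaHilbertModule.toCLM_rep T))

theorem hom_ext_of_simpleTensor {K : SigmaHilbertModule.{u₂, max v w} B}
    {L : SigmaHilbertModule.{u₁, max v w} A} {S T : tensorObj.{u₁, u₂, v, w} h K ⟶ L}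
    (hST : ∀ (x : E) (ζ : K.carrier),
      toCLM S (simpleTensor K.rep x ζ) = toCLM T (simpleTensor K.rep x ζ)) : S = T :=
  SigmaHilbertModule.Hom.ext
    (clm_ext_of_dense_span (dense_span_simpleTensor K.rep) fun p => hST p.1 p.2)

theorem toCLM_tensorHom {K L : SigmaHilbertModule.{u₂, max v w} B} (T : K ⟶ L) (x : E)
    (ζ : K.carrier) : toCLM (tensorHom.{u₁, u₂, v, w} h T) (simpleTensor K.rep x ζ)
      = simpleTensor L.rep x (toCLM T ζ) :=
  tensorMap_simpleTensor (toCLM T) (SigmaHilbertModule.toCLM_rep T) x ζ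

/-- The functor `K ↦ E ⊗ K`. -/
noncomputable def tensorFunctor :
    SigmaHilbertModule.{u₂, max v w} B ⥤ SigmaHilbertModule.{u₁, max v w} A where
  obj K := tensorObj.{u₁, u₂, v, w} h K
  map T := tensorHom.{u₁, u₂, v, w} h T
  map_id K := h.hom_ext_of_simpleTensor fun x ζ => h.toCLM_tensorHom _ x ζ
  map_comp S T := h.hom_ext_of_simpleTensor fun x ζ => by
    refine (h.toCLM_tensorHom _ x ζ).trans ?_
    change _ = toCLM (tensorHom.{u₁, u₂, v, w} h T) (toCLM (tensorHom.{u₁, u₂, v, w} h S) _)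
    rw [toCLM_tensorHom, toCLM_tensorHom]
    rfl

theorem isTensorFunctor_tensorFunctor [PartialOrder A] [StarOrderedRing A] :
    IsTensorFunctor E act (tensorFunctor.{u₁, u₂, v, w} h) :=
  ⟨fun K => LinearIsometryEquiv.refl ℂ (InteriorTensor E K.rep),
    fun K a x ζ => h.rep_simpleTensor K.rep a x ζ, fun _ _ T x ζ => h.toCLM_tensorHom T x ζ⟩

theorem isStarFunctor_tensorFunctor : IsStarFunctor (tensorFunctor.{u₁, u₂, v, w} h) where
  map_add {K L} S T := h.hom_ext_of_simpleTensor fun x ζ => by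
    refine (h.toCLM_tensorHom _ x ζ).trans ?_
    change _ = toCLM (tensorHom.{u₁, u₂, v, w} h S) _ + toCLM (tensorHom.{u₁, u₂, v, w} h T) _
    rw [toCLM_tensorHom, toCLM_tensorHom]
    exact map_add (creation L.rep x) (toCLM S ζ) (toCLM T ζ)
  map_smul {K L} z T := h.hom_ext_of_simpleTensor fun x ζ => by
    refine (h.toCLM_tensorHom _ x ζ).trans ?_
    change _ = z • toCLM (tensorHom.{u₁, u₂, v, w} h T) _
    rw [toCLM_tensorHom]
    exact map_smul (creation L.rep x) z (toCLM T ζ)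
  map_adjoint {K L} T := SigmaHilbertModule.Hom.ext
    (tensorMap_adjoint (toCLM T) (SigmaHilbertModule.toCLM_rep T)
      (SigmaHilbertModule.toCLM_rep (adjoint T)))

end Functor

/-! ### Composites of two tensor functors -/

section Equivalence

variable {A : Type u₁} {B : Type u₂} {E E' : Type v}
  [NonUnitalCStarAlgebra A] [PartialOrder A] [StarOrderedRing A] [SigmaStarAlgebra A]
  [NonUnitalCStarAlgebra B] [PartialOrder B] [StarOrderedRing B] [SigmaStarAlgebra B]
  [AddCommGroup E] [Module ℂ E] [RightCStarModule B E] {act : A → E → E}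
  [AddCommGroup E'] [Module ℂ E'] [RightCStarModule A E'] {act' : B → E' → E'}
  (h : IsSigmaCorrespondence A B act) (h' : IsSigmaCorrespondence B A act')

/-- The vectors `x ⊗ (x' ⊗ ζ)` span a dense subspace of `E ⊗ (E' ⊗ K)`. -/
theorem dense_span_simpleTensor_simpleTensor (K : SigmaHilbertModule.{u₁, w} A) :
    Dense (Submodule.span ℂ (Set.range fun q : E × E' × K.carrier =>
      simpleTensor (h'.rep K.rep) q.1 (simpleTensor K.rep q.2.1 q.2.2)) :
      Set (InteriorTensor E (h'.rep K.rep))) :=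
  dense_span_simpleTensor_of_dense_span (h'.rep K.rep)
    (f := fun p : E' × K.carrier => simpleTensor K.rep p.1 p.2) (dense_span_simpleTensor K.rep)

/-- Given a pairing `p` of `E` and `E'` which is compatible with the inner products, the module
`E ⊗ (E' ⊗ K)` is identified with `K` by `x ⊗ (x' ⊗ ζ) ↦ p(x, x') ζ`. -/
theorem exists_unitary_of_pairing (p : E → E' → A)
    (hp : ∀ x y x' y',
      (rightInner x' (act' (rightInner x y : B) y') : A) = star (p x x') * p y y')
    (hfull : sigmaClosure (Submodule.span ℂ {a : A | ∃ x x', p x x' = a} : Set A) = Set.univ)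
    (K : SigmaHilbertModule.{u₁, w} A) :
    ∃ U : InteriorTensor E (h'.rep K.rep) ≃ₗᵢ[ℂ] K.carrier,
      ∀ (x : E) (x' : E') (ζ : K.carrier),
        U (simpleTensor (h'.rep K.rep) x (simpleTensor K.rep x' ζ)) = K.rep (p x x') ζ := by
  have hdense : Dense (Submodule.span ℂ (Set.range fun q : E × E' × K.carrier =>
      K.rep (p q.1 q.2.1) q.2.2) : Set K.carrier) := by
    refine dense_span_of_forall_inner_eq_zero fun v hv => K.eq_zero_of_inner_rep fun a ζ => ?_
    refine K.inner_rep_eq_zero hfull ?_ a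
    rintro _ ⟨x, x', rfl⟩
    rw [← inner_conj_symm, hv _ ⟨(x, x', ζ), rfl⟩, map_zero]
  -- Unfolding both tensor products gives `⟨ζ, π(⟨x'|⟨x|y⟩y'⟩) η⟩`, which `hp` turns into `⟨π(p x
  -- x') ζ, π(p y y') η⟩`. Equal Gram matrices suffice for the unitary, so `p` need not be assumed
  -- bilinear.
  have hinner : ∀ q r : E × E' × K.carrier,
      inner ℂ (simpleTensor (h'.rep K.rep) q.1 (simpleTensor K.rep q.2.1 q.2.2))
        (simpleTensor (h'.rep K.rep) r.1 (simpleTensor K.rep r.2.1 r.2.2))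
      = inner ℂ (K.rep (p q.1 q.2.1) q.2.2) (K.rep (p r.1 r.2.1) r.2.2) := fun q r => by
    rw [inner_simpleTensor, rep_simpleTensor, inner_simpleTensor, hp, map_mul,
      mul_apply_eq_comp, map_star, ContinuousLinearMap.star_eq_adjoint,
      ContinuousLinearMap.adjoint_inner_right]
  obtain ⟨U, hU⟩ := exists_unitary_of_inner_eq
    (dense_span_simpleTensor_simpleTensor h' K) hdense hinner
  exact ⟨U, fun x x' ζ => hU (x, x', ζ)⟩

/-- The identification of `E ⊗ (E' ⊗ K)` with `K` intertwines the actions of `A`. -/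
theorem unitary_rep_of_pairing (p : E → E' → A) (hact : ∀ a x x', p (act a x) x' = a * p x x')
    (K : SigmaHilbertModule.{u₁, w} A) (U : InteriorTensor E (h'.rep K.rep) ≃ₗᵢ[ℂ] K.carrier)
    (hU : ∀ (x : E) (x' : E') (ζ : K.carrier),
        U (simpleTensor (h'.rep K.rep) x (simpleTensor K.rep x' ζ)) = K.rep (p x x') ζ)
    (a : A) (ξ : InteriorTensor E (h'.rep K.rep)) :
    U (h.rep (h'.rep K.rep) a ξ) = K.rep a (U ξ) := by
  let V : InteriorTensor E (h'.rep K.rep) →L[ℂ] K.carrier :=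
    U.toContinuousLinearEquiv.toContinuousLinearMap
  have hV : ∀ η, V η = U η := fun _ => rfl
  have : V.comp (h.rep (h'.rep K.rep) a) = (K.rep a).comp V :=
    clm_ext_of_dense_span (dense_span_simpleTensor_simpleTensor h' K) fun q => by
      rw [ContinuousLinearMap.comp_apply, ContinuousLinearMap.comp_apply, rep_simpleTensor, hV, hV,
        hU, hU, hact, map_mul, mul_apply_eq_comp]
  exact congrArg (fun S : InteriorTensor E (h'.rep K.rep) →L[ℂ] K.carrier => S ξ) this

/-- A pairing of `E` and `E'` which is compatible with the inner products and the action induces a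
natural isomorphism of `K ↦ E ⊗ (E' ⊗ K)` with the identity functor. -/
theorem nonempty_iso_of_pairing (p : E → E' → A)
    (hp : ∀ x y x' y',
      (rightInner x' (act' (rightInner x y : B) y') : A) = star (p x x') * p y y')
    (hact : ∀ a x x', p (act a x) x' = a * p x x')
    (hfull : sigmaClosure (Submodule.span ℂ {a : A | ∃ x x', p x x' = a} : Set A) = Set.univ) :
    Nonempty (tensorFunctor.{u₂, u₁, v, w} h' ⋙ tensorFunctor.{u₁, u₂, v, w} h ≅
      𝟭 (SigmaHilbertModule.{u₁, max v w} A)) := by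
  choose U hU using fun K : SigmaHilbertModule.{u₁, max v w} A =>
    h'.exists_unitary_of_pairing p hp hfull K
  have hrep := fun K : SigmaHilbertModule.{u₁, max v w} A =>
    unitary_rep_of_pairing h h' p hact K (U K) (hU K)
  refine ⟨NatIso.ofComponents (fun K =>
    { hom := SigmaHilbertModule.Hom.mk
        (H := tensorObj.{u₁, u₂, v, w} h (tensorObj.{u₂, u₁, v, w} h' K))
        (U K).toContinuousLinearEquiv.toContinuousLinearMap (hrep K)
      inv := SigmaHilbertModule.Hom.mk
        (K := tensorObj.{u₁, u₂, v, w} h (tensorObj.{u₂, u₁, v, w} h' K))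
        (U K).symm.toContinuousLinearEquiv.toContinuousLinearMap fun a ξ => by
          change (U K).symm _ = h.rep (h'.rep K.rep) a ((U K).symm ξ)
          rw [LinearIsometryEquiv.symm_apply_eq, hrep, LinearIsometryEquiv.apply_symm_apply]
          rfl
      hom_inv_id := SigmaHilbertModule.Hom.ext
        (ContinuousLinearMap.ext fun ξ => (U K).symm_apply_apply ξ)
      inv_hom_id := SigmaHilbertModule.Hom.ext
        (ContinuousLinearMap.ext fun ξ => (U K).apply_symm_apply ξ) }) fun {K L} T => ?_⟩
  -- On elementary tensors naturality reads `p(x, x') T ζ = T (p(x, x') ζ)`, which holds because `T`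
  -- is a module map.
  refine SigmaHilbertModule.Hom.ext (clm_ext_of_dense_span
    (dense_span_simpleTensor_simpleTensor h' K) fun q => ?_)
  change U L (toCLM (tensorHom.{u₁, u₂, v, w} h (tensorHom.{u₂, u₁, v, w} h' T))
    (simpleTensor _ q.1 (simpleTensor _ q.2.1 q.2.2))) = toCLM T (U K _)
  have e1 := h.toCLM_tensorHom (tensorHom.{u₂, u₁, v, w} h' T) q.1
    (simpleTensor K.rep q.2.1 q.2.2)
  have e2 := h'.toCLM_tensorHom T q.2.1 q.2.2
  rw [e2] at e1
  refine (congrArg (U L) e1).trans ((hU L _ _ _).trans ?_)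
  rw [hU]
  exact (T.map_rep _ _).symm

end Equivalence

end IsSigmaCorrespondence

/-! ### Imprimitivity bimodules -/

namespace IsSigmaImprimitivityBimodule

variable {A : Type u₁} {B : Type u₂} {X : Type v}
  [NonUnitalCStarAlgebra A] [PartialOrder A] [StarOrderedRing A] [SigmaStarAlgebra A]
  [NonUnitalCStarAlgebra B] [PartialOrder B] [StarOrderedRing B] [SigmaStarAlgebra B]
  [AddCommGroup X] [Module ℂ X] [LeftCStarModule A X] [RightCStarModule B X]
  (h : IsSigmaImprimitivityBimodule A B X)

include h

/-- Here `⟨x|y⟩b = ⟨x|yb⟩ = 0`, and the inner products have σ-dense span. Identities in `B` can thus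
be checked by letting both sides act on `X`. -/
theorem eq_zero_of_forall_rightAct (b : B) (hb : ∀ z : X, rightAct z b = 0) : b = 0 := by
  refine eq_zero_of_forall_mul_eq_zero h.right_full b ?_
  rintro _ ⟨x, y, rfl⟩
  have h0 : (rightInner x (0 : X) : B) = 0 := by
    simpa using RightCStarModule.rightInner_smul (B := B) x (0 : X) 0
  rw [← RightCStarModule.rightInner_rightAct, hb, h0]

theorem eq_zero_of_forall_leftAct (a : A) (ha : ∀ z : X, leftAct a z = 0) : a = 0 := by
  -- From `⟨x|a y⟩ = ⟨x|y⟩a*` it is `star a` that appears as the right factor.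
  rw [← star_eq_zero]
  refine eq_zero_of_forall_mul_eq_zero h.left_full (star a) ?_
  rintro _ ⟨x, y, rfl⟩
  have h0 : (leftInner x (0 : X) : A) = 0 := by
    simpa using leftInner_smul_right (B := A) 0 x (0 : X)
  rw [← leftInner_leftAct_right, ha, h0]

/-- `A` acts by adjointable operators on the right module. -/
theorem rightInner_leftAct (a : A) (x y : X) :
    (rightInner (leftAct a x) y : B) = rightInner x (leftAct (star a) y) := by
  rw [← sub_eq_zero]
  refine h.eq_zero_of_forall_rightAct _ fun z => ?_
  let f : B →+ X := AddMonoidHom.mk' (rightAct z) (RightCStarModule.rightAct_add z)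
  change f _ = 0
  rw [map_sub, sub_eq_zero]
  change rightAct z _ = rightAct z _
  -- `z⟨ax|y⟩ = ⟨z|ax⟩y = ⟨z|x⟩a*y = z⟨x|a*y⟩`.
  rw [← h.inner_act, ← h.inner_act, leftInner_leftAct_right, LeftCStarModule.mul_leftAct]

/-- `B` acts by adjointable operators on the left module. -/
theorem leftInner_rightAct (b : B) (x y : X) :
    (leftInner (rightAct x b) y : A) = leftInner x (rightAct y (star b)) := by
  rw [← sub_eq_zero]
  refine h.eq_zero_of_forall_leftAct _ fun z => ?_
  let f : A →+ X := AddMonoidHom.mk' (fun a => leftAct a z)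
    fun a c => LeftCStarModule.add_leftAct a c z
  change f _ = 0
  rw [map_sub, sub_eq_zero]
  change leftAct _ z = leftAct _ z
  rw [h.inner_act, h.inner_act, rightInner_rightAct_left, star_star,
    RightCStarModule.rightAct_mul]

/-- `X` is a correspondence from `A` to `B`. -/
theorem isSigmaCorrespondence :
    IsSigmaCorrespondence A B (fun (a : A) (x : X) => leftAct a x) where
  act_add := LeftCStarModule.leftAct_add
  add_act := LeftCStarModule.add_leftAct
  mul_act := LeftCStarModule.mul_leftAct
  act_smul := LeftCStarModule.leftAct_smul
  smul_act := LeftCStarModule.smul_leftAct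
  rightInner_act := h.rightInner_leftAct
  sigmaConv_act a a₀ ha x y := by
    -- In the left module the convergence `a n y → a₀ y` is immediate from `⟨a y|z⟩ = a⟨y|z⟩`. The
    -- field `converges_iff` transports it to the `B`-valued inner product, and the adjoint moves it
    -- to the second variable.
    have hl : LeftSigmaConverges A X (fun n => leftAct (a n) y) (leftAct a₀ y) := fun z => by
      simp only [LeftCStarModule.leftAct_leftInner]
      exact sigmaConv_mul_right ha _
    simpa only [RightCStarModule.star_rightInner] using
      sigmaConv_star ((h.converges_iff _ _).mp hl x)
  exists_act_eq x y z := ⟨leftInner x y, h.inner_act x y z⟩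
  full := h.right_full

/-- The conjugate of `X` is a correspondence from `B` to `A`. -/
theorem isSigmaCorrespondence_conjugate :
    IsSigmaCorrespondence B A
      (fun (b : B) (x : Conjugate X) => Conjugate.bar (rightAct x.unbar (star b))) where
  act_add b x y := Conjugate.ext (RightCStarModule.add_rightAct _ _ _)
  add_act b c x := Conjugate.ext (by
    change rightAct x.unbar (star (b + c)) = rightAct x.unbar (star b) + rightAct x.unbar (star c)
    rw [star_add, RightCStarModule.rightAct_add])
  mul_act b c x := Conjugate.ext (by
    change rightAct x.unbar (star (b * c)) = rightAct (rightAct x.unbar (star c)) (star b)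
    rw [star_mul, RightCStarModule.rightAct_mul])
  act_smul z b x := Conjugate.ext (RightCStarModule.smul_rightAct _ _ _)
  smul_act z b x := Conjugate.ext (by
    change rightAct x.unbar (star (z • b)) = conj z • rightAct x.unbar (star b)
    rw [star_smul, RightCStarModule.rightAct_smul]; rfl)
  rightInner_act b x y := h.leftInner_rightAct _ _ _
  sigmaConv_act b b₀ hb x y := by
    have hr : RightSigmaConverges B X (fun n => rightAct y.unbar (star (b n)))
        (rightAct y.unbar (star b₀)) := fun z => by
      simp only [rightInner_rightAct_left, star_star]
      exact sigmaConv_mul_right hb _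
    have := sigmaConv_star ((h.converges_iff _ _).mpr hr x.unbar)
    simp only [LeftCStarModule.star_leftInner] at this
    exact this
  -- Since `b` acts on the conjugate through `b*`, the required identity becomes `z⟨y|x⟩ = ⟨z|y⟩x`
  -- in `X`.
  exists_act_eq x y z := ⟨star (rightInner y.unbar x.unbar), Conjugate.ext (by
    change rightAct z.unbar (star (star (rightInner y.unbar x.unbar : B)))
      = leftAct (star (leftInner y.unbar z.unbar : A)) x.unbar
    rw [star_star, LeftCStarModule.star_leftInner, h.inner_act])⟩
  full := by
    have hs : {a : A | ∃ x y : Conjugate X, rightInner x y = a}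
        = {a : A | ∃ x y : X, leftInner x y = a} :=
      Set.ext fun a => ⟨fun ⟨x, y, hxy⟩ => ⟨x.unbar, y.unbar, hxy⟩,
        fun ⟨x, y, hxy⟩ => ⟨.bar x, .bar y, hxy⟩⟩
    rw [IsRightSigmaFull, hs]
    exact h.left_full

theorem sigmaClosure_leftInner_conjugate :
    sigmaClosure (Submodule.span ℂ {a : A | ∃ (x : X) (y : Conjugate X),
      leftInner x y.unbar = a} : Set A) = Set.univ := by
  have hs : {a : A | ∃ (x : X) (y : Conjugate X), leftInner x y.unbar = a}
      = {a : A | ∃ x y : X, leftInner x y = a} :=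
    Set.ext fun a => ⟨fun ⟨x, y, hxy⟩ => ⟨x, y.unbar, hxy⟩, fun ⟨x, y, hxy⟩ => ⟨x, .bar y, hxy⟩⟩
  rw [hs]
  exact h.left_full

theorem sigmaClosure_rightInner_conjugate :
    sigmaClosure (Submodule.span ℂ {b : B | ∃ (x : Conjugate X) (y : X),
      rightInner x.unbar y = b} : Set B) = Set.univ := by
  have hs : {b : B | ∃ (x : Conjugate X) (y : X), rightInner x.unbar y = b}
      = {b : B | ∃ x y : X, rightInner x y = b} :=
    Set.ext fun a => ⟨fun ⟨x, y, hxy⟩ => ⟨x.unbar, y, hxy⟩, fun ⟨x, y, hxy⟩ => ⟨.bar x, y, hxy⟩⟩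
  rw [hs]
  exact h.right_full

/-- The pairing is the left inner product. Its compatibility is `⟨x'|y'⟨y|x⟩⟩ = ⟨x'|⟨y'|y⟩x⟩ =
⟨x'|x⟩⟨y|y'⟩` for the `A`-valued outer product. -/
theorem nonempty_conjugate_comp_iso :
    Nonempty (IsSigmaCorrespondence.tensorFunctor.{u₂, u₁, v, w} h.isSigmaCorrespondence_conjugate
      ⋙ IsSigmaCorrespondence.tensorFunctor.{u₁, u₂, v, w} h.isSigmaCorrespondence ≅
      𝟭 (SigmaHilbertModule.{u₁, max v w} A)) := by
  refine h.isSigmaCorrespondence.nonempty_iso_of_pairing h.isSigmaCorrespondence_conjugate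
    (fun x y => leftInner x y.unbar) (fun x y x' y' => ?_)
    (fun a x x' => LeftCStarModule.leftAct_leftInner a x x'.unbar)
    h.sigmaClosure_leftInner_conjugate
  change (leftInner x'.unbar (rightAct y'.unbar (star (rightInner x y : B))) : A) = _
  rw [RightCStarModule.star_rightInner, ← h.inner_act, leftInner_leftAct_right,
    LeftCStarModule.star_leftInner, LeftCStarModule.star_leftInner]

/-- The pairing is the right inner product, with compatibility `⟨x'|⟨x|y⟩y'⟩ = ⟨x'|x⟨y|y'⟩⟩ =
⟨x'|x⟩⟨y|y'⟩` in `B`. -/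
theorem nonempty_comp_conjugate_iso :
    Nonempty (IsSigmaCorrespondence.tensorFunctor.{u₁, u₂, v, w} h.isSigmaCorrespondence
      ⋙ IsSigmaCorrespondence.tensorFunctor.{u₂, u₁, v, w} h.isSigmaCorrespondence_conjugate ≅
      𝟭 (SigmaHilbertModule.{u₂, max v w} B)) := by
  refine h.isSigmaCorrespondence_conjugate.nonempty_iso_of_pairing h.isSigmaCorrespondence
    (fun x y => rightInner x.unbar y) (fun x y x' y' => ?_) (fun b x x' => ?_)
    h.sigmaClosure_rightInner_conjugate
  · change (rightInner x' (leftAct (leftInner x.unbar y.unbar : A) y') : B) = _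
    rw [h.inner_act, RightCStarModule.rightInner_rightAct, RightCStarModule.star_rightInner]
  · change (rightInner (rightAct x.unbar (star b)) x' : B) = _
    rw [rightInner_rightAct_left, star_star]

end IsSigmaImprimitivityBimodule

end SigmaStar

theorem mainTheorem6 {A : Type u₁} {B : Type u₂}
    [NonUnitalCStarAlgebra A] [PartialOrder A] [StarOrderedRing A] [SigmaStarAlgebra A]
    [NonUnitalCStarAlgebra B] [PartialOrder B] [StarOrderedRing B] [SigmaStarAlgebra B] :
    (StronglySigmaMoritaEquivalent.{u₁, u₂, v} A B →
      WeaklySigmaMoritaEquivalent.{u₁, u₂, max v w} A B) ∧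
    ∀ (X : Type v) [AddCommGroup X] [Module ℂ X] [LeftCStarModule A X] [RightCStarModule B X],
      IsSigmaImprimitivityBimodule A B X →
      ∃ (F : SigmaHilbertModule.{u₁, max v w} A ⥤ SigmaHilbertModule.{u₂, max v w} B)
        (G : SigmaHilbertModule.{u₂, max v w} B ⥤ SigmaHilbertModule.{u₁, max v w} A),
        IsStarFunctor F ∧ IsStarFunctor G ∧
        IsTensorFunctor (Conjugate X)
          (fun (b : B) (x : Conjugate X) =>
            Conjugate.bar (RightCStarModule.rightAct x.unbar (star b))) F ∧
        IsTensorFunctor X (fun (a : A) (x : X) => LeftCStarModule.leftAct a x) G ∧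
        Nonempty (F ⋙ G ≅ 𝟭 (SigmaHilbertModule.{u₁, max v w} A)) ∧
        Nonempty (G ⋙ F ≅ 𝟭 (SigmaHilbertModule.{u₂, max v w} B)) := by
  have key : ∀ (X : Type v) [AddCommGroup X] [Module ℂ X] [LeftCStarModule A X]
      [RightCStarModule B X], IsSigmaImprimitivityBimodule A B X →
      ∃ (F : SigmaHilbertModule.{u₁, max v w} A ⥤ SigmaHilbertModule.{u₂, max v w} B)
        (G : SigmaHilbertModule.{u₂, max v w} B ⥤ SigmaHilbertModule.{u₁, max v w} A),
        IsStarFunctor F ∧ IsStarFunctor G ∧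
        IsTensorFunctor (Conjugate X)
          (fun (b : B) (x : Conjugate X) =>
            Conjugate.bar (RightCStarModule.rightAct x.unbar (star b))) F ∧
        IsTensorFunctor X (fun (a : A) (x : X) => LeftCStarModule.leftAct a x) G ∧
        Nonempty (F ⋙ G ≅ 𝟭 (SigmaHilbertModule.{u₁, max v w} A)) ∧
        Nonempty (G ⋙ F ≅ 𝟭 (SigmaHilbertModule.{u₂, max v w} B)) := by
    intro X _ _ _ _ h
    exact ⟨_, _, h.isSigmaCorrespondence_conjugate.isStarFunctor_tensorFunctor,
      h.isSigmaCorrespondence.isStarFunctor_tensorFunctor,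
      h.isSigmaCorrespondence_conjugate.isTensorFunctor_tensorFunctor,
      h.isSigmaCorrespondence.isTensorFunctor_tensorFunctor,
      h.nonempty_conjugate_comp_iso, h.nonempty_comp_conjugate_iso⟩
  refine ⟨?_, key⟩
  rintro ⟨X, _, _, _, _, h⟩
  obtain ⟨F, G, hF, hG, -, -, hFG, hGF⟩ := key X h
  exact ⟨F, G, hF, hG, hFG, hGF⟩
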